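/- **Corollary (Exponential decay of the Green's function).** Let $d\ge 1$, $D=(0,1)^d$, let $\varepsilon=1/N$ with $N\in\mathbb N$, $N\ge1$, and divide $D$ (understood periodically, i.e. modulo $\mathbb Z^d$) into the $N^d$ closed cubes of side $\varepsilon$ with vertices in $\varepsilon\mathbb Z^d$. Let $\mathcal T_\beta$ be a non-empty set of these cells, $\mathcal T_\alpha$ the set of the others, and let $V=\beta$ on the cells in $\mathcal T_\beta$ and $V=\alpha$ on those in $\mathcal T_\alpha$, where $0\le\alpha\le\beta$ and $\beta\ge c_0\,\varepsilon^{-2}$ for a fixed $c_0>0$. On $\mathcal V=H^1_{\rm per}(D)$ put $$a(u,v)=\int_D\nabla u\cdot\nabla v+V\,u\,v\,dx,\qquad |||u|||^2=a(u,u),\qquad |||u|||_S^2=\int_S|\nabla u|^2+V|u|^2\,dx\quad(S\subseteq D).$$ Let $\mathcal Q_\alpha$ be the set of maximal cubes that are unions of cells of $\mathcal T_\alpha$ (cubes may cross $\partial D$ by periodicity). Let $\varepsilon L$ be the largest side length of a cube in $\mathcal Q_\alpha$, and let $\kappa$ be the largest number of cubes of $\mathcal Q_\alpha$ containing a common cell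 of $\mathcal T_\alpha$; if $\mathcal T_\alpha=\emptyset$ put $L=\kappa=1$. For a node $z$ of the periodic mesh let $D_z$ be the cube of side $2\varepsilon$ centred at $z$ (periodically interpreted), let $\mathcal V_z=H^1_0(D_z)\subseteq\mathcal V$, let $\mathcal P_z:\mathcal V\to\mathcal V_z$ be the $a$-orthogonal projection, and let $\mathcal P=\sum_z\mathcal P_z$. There are constants $C_1,C_2>0$ depending only on $d$ and $c_0$ such that, for all $N,\mathcal T_\beta,\alpha,\beta$ as above, with $$K_1=C_1\,2^{d+1}\bigl(1+(\kappa L^d)^2L^2\bigr),\quad K_2=2^d,\quad \vartheta=\frac1{K_2+K_1^{-1}},\quad \gamma_{\mathcal P}=\frac{K_2}{K_1^{-1}+K_2},$$ the following holds. We have $0<\gamma_{\mathcal P}<1$; the projections $\mathcal P_z$ exist and $|||v-\vartheta\mathcal P v|||\le\gamma_{\mathcal P}\,|||v|||$ for all $v\in\mathcal V$. For every $f\in L^2(D)$ there is exactly one $u\in\mathcal V$ with $a(u,v)=\int_D f\,v\,dx$ for all $v\in\mathcal V$, and $$|||u|||_{D\setminus B^\infty_{k\varepsilon}(\operatorname{supp}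 f)}\le C_2\,\gamma_{\mathcal P}^{\,k}\,|||u|||\qquad\text{for all } k=0,1,2,\dots,$$ where $\operatorname{supp} f$ is the essential support of $f$ and $B^\infty_r(S)$ is the set of points whose distance from $S$, in the sup norm modulo $\mathbb Z^d$, is less than $r$. -/

import Mathlib

open MeasureTheory
open scoped ContDiff

noncomputable section

namespace Schrodinger

/-! ### Periodic Sobolev spaces on the unit cube -/

/-- The unit cube `D = (0,1)^d`. -/
def unitCube (d : ℕ) : Set (Fin d → ℝ) := {x | ∀ i, 0 < x i ∧ x i < 1}

/-- Lebesgue measure on `D`. -/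
def cubeMeasure (d : ℕ) : Measure (Fin d → ℝ) := volume.restrict (unitCube d)

/-- The space `L²(D)`. -/
abbrev L2 (d : ℕ) : Type := Lp ℝ 2 (cubeMeasure d)

/-- `L²(D) × L²(D)^d`, the ambient space of the pairs `(u, ∇u)`: `p.1` is the function and
`p.2 i` is its `i`-th partial derivative. Its topology is the one of the `H¹` norm. -/
abbrev L2Pair (d : ℕ) : Type := L2 d × (Fin d → L2 d)

/-- `φ : ℝ^d → ℝ` is periodic with respect to `ℤ^d`. -/
def IsPeriodic {d : ℕ} (φ : (Fin d → ℝ) → ℝ) : Prop :=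
  ∀ (x : Fin d → ℝ) (k : Fin d → ℤ), φ (fun i => x i + k i) = φ x

/-- The pairs `(φ, ∇φ)`, restricted to `D`, of the smooth periodic functions `φ` whose support is
contained in `U` (a `ℤ^d`-periodic open subset of `ℝ^d`). -/
def smoothPairs {d : ℕ} (U : Set (Fin d → ℝ)) : Submodule ℝ (L2Pair d) where
  carrier := {p | ∃ φ : (Fin d → ℝ) → ℝ, ContDiff ℝ ∞ φ ∧ IsPeriodic φ ∧ tsupport φ ⊆ U ∧
    p.1 =ᵐ[cubeMeasure d] φ ∧
    ∀ i, p.2 i =ᵐ[cubeMeasure d] fun x => fderiv ℝ φ x (Pi.single i 1)}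
  zero_mem' := by
    refine ⟨fun _ => 0, contDiff_const, fun _ _ => rfl, ?_, Lp.coeFn_zero _ _ _, fun i => ?_⟩
    · have h : tsupport (fun _ : Fin d → ℝ => (0 : ℝ)) = ∅ := tsupport_eq_empty_iff.2 rfl
      rw [h]
      exact Set.empty_subset _
    · filter_upwards [Lp.coeFn_zero ℝ 2 (cubeMeasure d)] with x hx
      simpa using hx
  add_mem' := by
    rintro p q ⟨φ, h1, h2, h3, h4, h5⟩ ⟨ψ, g1, g2, g3, g4, g5⟩
    refine ⟨φ + ψ, h1.add g1, fun x k => ?_, ?_, ?_, fun i => ?_⟩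
    · simp only [Pi.add_apply, h2 x k, g2 x k]
    · exact (tsupport_add φ ψ).trans (Set.union_subset h3 g3)
    · filter_upwards [Lp.coeFn_add p.1 q.1, h4, g4] with x hx hy hz
      rw [Prod.fst_add, hx, Pi.add_apply, Pi.add_apply, hy, hz]
    · filter_upwards [Lp.coeFn_add (p.2 i) (q.2 i), h5 i, g5 i] with x hx hy hz
      rw [Prod.snd_add, Pi.add_apply, hx, Pi.add_apply, hy, hz,
        fderiv_add (h1.differentiable (by simp) x) (g1.differentiable (by simp) x)]
      rfl
  smul_mem' := by
    rintro c p ⟨φ, h1, h2, h3, h4, h5⟩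
    refine ⟨c • φ, contDiff_const.smul h1, fun x k => ?_, ?_, ?_, fun i => ?_⟩
    · simp only [Pi.smul_apply, h2 x k]
    · exact (closure_mono (Function.support_const_smul_subset c φ)).trans h3
    · filter_upwards [Lp.coeFn_smul c p.1, h4] with x hx hy
      rw [Prod.smul_fst, hx, Pi.smul_apply, Pi.smul_apply, hy]
    · filter_upwards [Lp.coeFn_smul c (p.2 i), h5 i] with x hx hy
      rw [Prod.smul_snd, Pi.smul_apply, hx, Pi.smul_apply, hy,
        fderiv_const_smul (h1.differentiable (by simp) x)]
      rfl

/-- The space `𝒱 = H¹_per(D)`: the closure of the smooth periodic functions in the `H¹(D)` norm. An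
element is a pair `(u, ∇u)`. -/
def H1per (d : ℕ) : Submodule ℝ (L2Pair d) := (smoothPairs Set.univ).topologicalClosure

/-! ### The mesh and the potential

The mesh has width `ε = 1 / N`. Its cells modulo `ℤ^d`, and likewise its nodes modulo `ℤ^d`, are
indexed by `(ℤ / N)^d`: the index `q` stands for the cube `ε (q + [0,1]^d)`, or for the node
`ε q`. -/

/-- Indices of the cells and of the nodes of the periodic mesh of width `1 / N`. -/
abbrev Index (d N : ℕ) : Type := Fin d → ZMod N

/-- The index of the mesh cell that contains `x`. -/
def cellOf {d : ℕ} (N : ℕ) (x : Fin d → ℝ) : Index d N :=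
  fun i => ((⌊(N : ℝ) * x i⌋ : ℤ) : ZMod N)

open Classical in
/-- The potential: `β` on the cells in `Tβ`, and `α` on all others. -/
def potential {d N : ℕ} (Tβ : Set (Index d N)) (α β : ℝ) (x : Fin d → ℝ) : ℝ :=
  if cellOf N x ∈ Tβ then β else α

/-- The cells of the cube with lower corner `c` and side length `m ε`, modulo `ℤ^d`. -/
def cubeCells {d N : ℕ} (c : Index d N) (m : ℕ) : Set (Index d N) :=
  {q | ∃ j : Fin d → ℕ, (∀ i, j i < m) ∧ ∀ i, q i = c i + (j i : ZMod N)}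

/-- `Q` is a cube that is a union of mesh cells, of side length between `ε` and `1`. -/
def IsMeshCube {d N : ℕ} (Q : Set (Index d N)) : Prop :=
  ∃ (c : Index d N) (m : ℕ), 1 ≤ m ∧ m ≤ N ∧ Q = cubeCells c m

/-- `Q` is a maximal cube among the mesh cubes contained in `T`. -/
def IsMaximalCube {d N : ℕ} (T Q : Set (Index d N)) : Prop :=
  IsMeshCube Q ∧ Q ⊆ T ∧ ∀ Q', IsMeshCube Q' → Q ⊆ Q' → Q' ⊆ T → Q' = Q

open Classical in
/-- The maximal width `L` (in units of `ε`) of a potential valley, where the valleys are the cells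
outside `Tβ`; it is `1` if there are none. -/
def valleyWidth {d N : ℕ} (Tβ : Set (Index d N)) : ℕ :=
  if Tβᶜ = ∅ then 1
  else sSup {m | 1 ≤ m ∧ m ≤ N ∧ ∃ c : Index d N, IsMaximalCube Tβᶜ (cubeCells c m)}

open Classical in
/-- The maximal number `κ` of overlapping maximal valley cubes; it is `1` if there are no
valleys. -/
def valleyOverlap {d N : ℕ} (Tβ : Set (Index d N)) : ℕ :=
  if Tβᶜ = ∅ then 1
  else sSup {n | ∃ q ∈ Tβᶜ, n = {Q | IsMaximalCube Tβᶜ Q ∧ q ∈ Q}.ncard}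

/-! ### Energy -/

/-- `∫_S ∇u · ∇v + V u v` for `S ⊆ D`. -/
def energyFormOn {d : ℕ} (V : (Fin d → ℝ) → ℝ) (S : Set (Fin d → ℝ)) (u v : L2Pair d) : ℝ :=
  ∫ x in S, ((∑ i, u.2 i x * v.2 i x) + V x * u.1 x * v.1 x)

/-- The bilinear form `a(u, v)`. -/
def energyForm {d : ℕ} (V : (Fin d → ℝ) → ℝ) (u v : L2Pair d) : ℝ :=
  energyFormOn V (unitCube d) u v

/-- The energy norm on `S ⊆ D`. -/
def energyNormOn {d : ℕ} (V : (Fin d → ℝ) → ℝ) (S : Set (Fin d → ℝ)) (u : L2Pair d) : ℝ :=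
  √(energyFormOn V S u u)

/-- The energy norm on `D`. -/
def energyNorm {d : ℕ} (V : (Fin d → ℝ) → ℝ) (u : L2Pair d) : ℝ :=
  energyNormOn V (unitCube d) u

/-- `u ∈ H¹_per(D)` is a weak solution of the periodic problem `-Δu + V u = f`. -/
def IsSolution {d : ℕ} (V : (Fin d → ℝ) → ℝ) (f : L2 d) (u : H1per d) : Prop :=
  ∀ v : H1per d, energyForm V u v = ∫ x in unitCube d, f x * (v : L2Pair d).1 x

/-! ### Local spaces and projections -/

/-- The interior of the patch of cells around the node `z`, extended periodically to `ℝ^d`: all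
open cubes of side length `2 / N` centred at a representative of the node. -/
def patch {d N : ℕ} (z : Index d N) : Set (Fin d → ℝ) :=
  {x | ∃ y : Fin d → ℤ, (∀ i, (y i : ZMod N) = z i) ∧ ∀ i, |x i - y i / N| < 1 / N}

/-- The space `𝒱_z = H¹_0(D_z)`: the closure in the `H¹` norm of the smooth functions with
compact support in the (periodically repeated) open patch of `z`. -/
def H10patch {d N : ℕ} (z : Index d N) : Submodule ℝ (L2Pair d) :=
  (smoothPairs (patch z)).topologicalClosure

/-- `Pz` is the `a`-orthogonal projection of `H¹_per(D)` onto `H¹_0(D_z)`. -/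
def IsLocalProjection {d N : ℕ} (V : (Fin d → ℝ) → ℝ) (z : Index d N)
    (Pz : H1per d →ₗ[ℝ] H1per d) : Prop :=
  ∀ u : H1per d, (Pz u : L2Pair d) ∈ H10patch z ∧
    ∀ v ∈ H10patch z, energyForm V (Pz u) v = energyForm V u v

/-! ### Supports and constants -/

/-- The support of `f ∈ L²(D)`: the points near which `f` does not vanish almost everywhere. -/
def essSupport {d : ℕ} (f : L2 d) : Set (Fin d → ℝ) :=
  {x | ∀ U ∈ nhds x, ¬ (∀ᵐ y ∂(cubeMeasure d), y ∈ U → f y = 0)}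

/-- The points at periodic sup-norm distance less than `r` from `S`. -/
def periodicBall {d : ℕ} (r : ℝ) (S : Set (Fin d → ℝ)) : Set (Fin d → ℝ) :=
  {x | ∃ y ∈ S, ∃ k : Fin d → ℤ, dist x (fun i => y i + k i) < r}

/-- `K₂ = 2^d`. -/
def K2 (d : ℕ) : ℝ := 2 ^ d

/-- `K₁ = C 2^(d+1) (1 + c² L²)` with `c = κ L^d`, where `C` is a generic constant. -/
def K1 {d N : ℕ} (C : ℝ) (Tβ : Set (Index d N)) : ℝ :=
  C * (2 ^ (d + 1) *
    (1 + ((valleyOverlap Tβ : ℝ) * (valleyWidth Tβ : ℝ) ^ d) ^ 2 * (valleyWidth Tβ : ℝ) ^ 2))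

/-- The scaling factor `ϑ = 1 / (K₂ + K₁⁻¹)`. -/
def scaling {d N : ℕ} (C : ℝ) (Tβ : Set (Index d N)) : ℝ := 1 / (K2 d + (K1 C Tβ)⁻¹)

/-- The contraction factor `γ = K₂ / (K₁⁻¹ + K₂)`. -/
def gammaP {d N : ℕ} (C : ℝ) (Tβ : Set (Index d N)) : ℝ := K2 d / ((K1 C Tβ)⁻¹ + K2 d)

end Schrodinger

end

namespace Schrodinger

/-! ### The energy form as a bilinear form -/

/-! The proof runs the damped additive Schwarz error iteration `w₀ = u`, `w_{k+1} = w_k - ϑ 𝒫 w_k`,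
and plays a norm bound against a support bound. The contraction property gives `|||w_k||| ≤ γ^k
|||u|||`. On the other hand `u - w_k` spreads by only one layer of patches per step. If `D_z` misses
`supp f`, then `𝒫_z u = 0` by the equation; if `D_z` is also disjoint from all patches carrying `u -
w_k`, then `𝒫_z (u - w_k) = 0`, hence `𝒫_z w_k = 0`. So `u = w_k` off the ball of radius `(k+1)ε`,
and the energy of `u` there is at most that of `w_k`. The index shift costs a factor `1/γ ≤ 2`. This
is `sub_correctionStep_iterate_mem` and `energyNormOn_le_of_contraction`.

For the contraction (`subspace_correction_contraction`), `1 - ϑ𝒫` is `a`-symmetric, and `K₁⁻¹ a ≤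
a(𝒫·,·) ≤ K₂ a` places it between `0` and `γ`. The upper bound holds because a point lies in at most
`2^d` patches. The lower bound is Lions' lemma for the decomposition `v = ∑ η_z v` by a smooth
periodic partition of unity. Differentiating `η_z` costs a multiple of `N² ‖v‖²`, which the
Friedrichs inequality `friedrichs_smooth` bounds by the energy.

That inequality, which also yields coercivity, comes from translations: a cube of side `(L+1)ε`
always meets a cell of `Tβ`, so every point reaches such a cell by a shift in `ε{0,…,L}^d`. There `V
= β ≥ c₀N²` controls the function, and the gradient controls the change along the shift. Summing
over all shifts gives the factor `L^(d+2)`, which is at most `(κL^d)²L²`. -/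

/-- A measurable potential with values in `[0, M]`. -/
structure IsBoundedPotential {d : ℕ} (V : (Fin d → ℝ) → ℝ) (M : ℝ) : Prop where
  measurable : Measurable V
  nonneg : ∀ x, 0 ≤ V x
  le : ∀ x, V x ≤ M

lemma measurableSet_unitCube (d : ℕ) : MeasurableSet (unitCube d) := by
  have : unitCube d = Set.univ.pi fun _ => Set.Ioo (0 : ℝ) 1 := by
    ext x; simp [unitCube, Set.mem_pi]
  rw [this]
  exact MeasurableSet.univ_pi fun _ => measurableSet_Ioo

lemma volume_unitCube (d : ℕ) : volume (unitCube d) = 1 := by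
  have : unitCube d = Set.univ.pi fun _ => Set.Ioo (0 : ℝ) 1 := by
    ext x; simp [unitCube, Set.mem_pi]
  rw [this, volume_pi_pi]
  simp

instance (d : ℕ) : IsProbabilityMeasure (cubeMeasure d) :=
  ⟨by simp [cubeMeasure, volume_unitCube]⟩

lemma integrable_mul_L2 {d : ℕ} (f g : L2 d) :
    Integrable (fun x => f x * g x) (cubeMeasure d) :=
  MemLp.integrable_mul (Lp.memLp f) (Lp.memLp g)

lemma integral_mul_L2 {d : ℕ} (f g : L2 d) :
    ∫ x, f x * g x ∂(cubeMeasure d) = inner ℝ f g := by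
  rw [L2.inner_def]
  exact integral_congr_ae (.of_forall fun x => by simp [mul_comm])

namespace IsBoundedPotential

variable {d : ℕ} {V : (Fin d → ℝ) → ℝ} {M : ℝ}

lemma bound_nonneg (hV : IsBoundedPotential V M) : 0 ≤ M := (hV.nonneg 0).trans (hV.le 0)

lemma integrable_potential (hV : IsBoundedPotential V M) (f g : L2 d) :
    Integrable (fun x => V x * f x * g x) (cubeMeasure d) := by
  have := (integrable_mul_L2 f g).bdd_mul (c := M) hV.measurable.aestronglyMeasurable
    (.of_forall fun x => by rw [Real.norm_of_nonneg (hV.nonneg x)]; exact hV.le x)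
  simpa only [mul_assoc] using this

lemma integrable_energy (hV : IsBoundedPotential V M) (u v : L2Pair d) :
    Integrable (fun x => (∑ i, u.2 i x * v.2 i x) + V x * u.1 x * v.1 x) (cubeMeasure d) :=
  (integrable_finsetSum _ fun i _ => integrable_mul_L2 (u.2 i) (v.2 i)).add
    (hV.integrable_potential u.1 v.1)

lemma integrableOn_energy (hV : IsBoundedPotential V M) {S : Set (Fin d → ℝ)}
    (hS : S ⊆ unitCube d) (u v : L2Pair d) :
    IntegrableOn (fun x => (∑ i, u.2 i x * v.2 i x) + V x * u.1 x * v.1 x) S :=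
  IntegrableOn.mono_set (hV.integrable_energy u v) hS

end IsBoundedPotential

section EnergyForm

variable {d : ℕ} {V : (Fin d → ℝ) → ℝ} {M : ℝ} {S : Set (Fin d → ℝ)}

lemma ae_restrict_of_cubeMeasure (hS : S ⊆ unitCube d) {p : (Fin d → ℝ) → Prop}
    (h : ∀ᵐ x ∂(cubeMeasure d), p x) : ∀ᵐ x ∂(volume.restrict S), p x :=
  ae_restrict_of_ae_restrict_of_subset hS h

lemma coeFn_pair_add (u v : L2Pair d) : ∀ᵐ x ∂(cubeMeasure d),
    (u + v).1 x = u.1 x + v.1 x ∧ ∀ i, (u + v).2 i x = u.2 i x + v.2 i x := by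
  filter_upwards [Lp.coeFn_add u.1 v.1, ae_all_iff.2 fun i => Lp.coeFn_add (u.2 i) (v.2 i)]
    with x h1 h2
  exact ⟨h1, h2⟩

lemma coeFn_pair_smul (c : ℝ) (u : L2Pair d) : ∀ᵐ x ∂(cubeMeasure d),
    (c • u).1 x = c * u.1 x ∧ ∀ i, (c • u).2 i x = c * u.2 i x := by
  filter_upwards [Lp.coeFn_smul c u.1, ae_all_iff.2 fun i => Lp.coeFn_smul c (u.2 i)]
    with x h1 h2
  exact ⟨h1, h2⟩

lemma energyFormOn_comm (V : (Fin d → ℝ) → ℝ) (S : Set (Fin d → ℝ)) (u v : L2Pair d) :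
    energyFormOn V S u v = energyFormOn V S v u := by
  unfold energyFormOn
  congr 1; ext x
  congr 1
  · exact Finset.sum_congr rfl fun i _ => mul_comm _ _
  · ring

lemma energyFormOn_add_left (hV : IsBoundedPotential V M) (hS : S ⊆ unitCube d)
    (u v w : L2Pair d) :
    energyFormOn V S (u + v) w = energyFormOn V S u w + energyFormOn V S v w := by
  unfold energyFormOn
  rw [← integral_add (hV.integrableOn_energy hS u w) (hV.integrableOn_energy hS v w)]
  refine integral_congr_ae ?_
  filter_upwards [ae_restrict_of_cubeMeasure hS (coeFn_pair_add u v)] with x hx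
  simp only [hx.1, hx.2, add_mul, mul_add, Finset.sum_add_distrib]
  ring

lemma energyFormOn_smul_left (hS : S ⊆ unitCube d) (c : ℝ)
    (u w : L2Pair d) :
    energyFormOn V S (c • u) w = c * energyFormOn V S u w := by
  unfold energyFormOn
  rw [← integral_const_mul]
  refine integral_congr_ae ?_
  filter_upwards [ae_restrict_of_cubeMeasure hS (coeFn_pair_smul c u)] with x hx
  simp only [hx.1, hx.2, mul_add, Finset.mul_sum]
  congr 1
  · exact Finset.sum_congr rfl fun i _ => by ring
  · ring

/-- `energyFormOn V S` as a bilinear form. -/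
noncomputable def energyBilin (hV : IsBoundedPotential V M) (hS : S ⊆ unitCube d) :
    LinearMap.BilinForm ℝ (L2Pair d) :=
  LinearMap.mk₂ ℝ (energyFormOn V S) (energyFormOn_add_left hV hS)
    (energyFormOn_smul_left hS)
    (fun u v w => by
      simp only [energyFormOn_comm V S u, energyFormOn_add_left hV hS])
    (fun c u v => by
      simp only [energyFormOn_comm V S u, energyFormOn_smul_left hS, smul_eq_mul])

@[simp] lemma energyBilin_apply (hV : IsBoundedPotential V M) (hS : S ⊆ unitCube d)
    (u v : L2Pair d) : energyBilin hV hS u v = energyFormOn V S u v := rfl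

lemma energy_density_nonneg (hV : IsBoundedPotential V M) (u : L2Pair d) (x : Fin d → ℝ) :
    0 ≤ (∑ i, u.2 i x * u.2 i x) + V x * u.1 x * u.1 x := by
  have := mul_nonneg (hV.nonneg x) (mul_self_nonneg (u.1 x))
  have h2 := Finset.sum_nonneg fun i (_ : i ∈ Finset.univ) => mul_self_nonneg (u.2 i x)
  rw [mul_assoc]
  linarith

lemma energyFormOn_self_nonneg (hV : IsBoundedPotential V M) (S : Set (Fin d → ℝ))
    (u : L2Pair d) : 0 ≤ energyFormOn V S u u :=
  integral_nonneg fun x => energy_density_nonneg hV u x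

lemma energyFormOn_self_mono (hV : IsBoundedPotential V M) {T : Set (Fin d → ℝ)}
    (hST : S ⊆ T) (hT : T ⊆ unitCube d) (u : L2Pair d) :
    energyFormOn V S u u ≤ energyFormOn V T u u :=
  setIntegral_mono_set (hV.integrableOn_energy hT u u)
    (.of_forall fun x => energy_density_nonneg hV u x) hST.eventuallyLE

lemma energyFormOn_sq_le (hV : IsBoundedPotential V M) (hS : S ⊆ unitCube d)
    (u v : L2Pair d) :
    energyFormOn V S u v ^ 2 ≤ energyFormOn V S u u * energyFormOn V S v v :=
  (energyBilin hV hS).apply_sq_le_of_symm (energyFormOn_self_nonneg hV S)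
    ⟨fun u v => energyFormOn_comm V S u v⟩ u v

lemma energyForm_self_eq (hV : IsBoundedPotential V M) (u : L2Pair d) :
    energyForm V u u =
      (∑ i, ‖u.2 i‖ ^ 2) + ∫ x, V x * u.1 x * u.1 x ∂(cubeMeasure d) := by
  have h : energyForm V u u =
      ∫ x, ((∑ i, u.2 i x * u.2 i x) + V x * u.1 x * u.1 x) ∂(cubeMeasure d) := rfl
  rw [h, integral_add (integrable_finsetSum _ fun i _ => integrable_mul_L2 (u.2 i) (u.2 i))
    (hV.integrable_potential u.1 u.1),
    integral_finsetSum _ fun i _ => integrable_mul_L2 (u.2 i) (u.2 i)]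
  simp only [integral_mul_L2, real_inner_self_eq_norm_sq]

lemma integral_potential_nonneg (hV : IsBoundedPotential V M) (f : L2 d) :
    0 ≤ ∫ x, V x * f x * f x ∂(cubeMeasure d) :=
  integral_nonneg fun x => by
    rw [Pi.zero_apply, mul_assoc]; exact mul_nonneg (hV.nonneg x) (mul_self_nonneg _)

lemma integral_potential_le (hV : IsBoundedPotential V M) (f : L2 d) :
    ∫ x, V x * f x * f x ∂(cubeMeasure d) ≤ M * ‖f‖ ^ 2 := by
  rw [← real_inner_self_eq_norm_sq, ← integral_mul_L2, ← integral_const_mul]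
  refine integral_mono (hV.integrable_potential f f) ((integrable_mul_L2 f f).const_mul M)
    fun x => ?_
  simp only [mul_assoc]
  exact mul_le_mul_of_nonneg_right (hV.le x) (mul_self_nonneg _)

lemma norm_fst_le_pair (u : L2Pair d) : ‖u.1‖ ≤ ‖u‖ := norm_fst_le u

lemma norm_snd_le_pair (u : L2Pair d) (i : Fin d) : ‖u.2 i‖ ≤ ‖u‖ :=
  (norm_le_pi_norm u.2 i).trans (norm_snd_le u)

lemma energyForm_self_le (hV : IsBoundedPotential V M) (u : L2Pair d) :
    energyForm V u u ≤ (d + M) * ‖u‖ ^ 2 := by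
  rw [energyForm_self_eq hV, add_mul]
  refine add_le_add ?_ ((integral_potential_le hV u.1).trans ?_)
  · refine (Finset.sum_le_sum fun i _ =>
      pow_le_pow_left₀ (norm_nonneg _) (norm_snd_le_pair u i) 2).trans ?_
    simp
  · exact mul_le_mul_of_nonneg_left
      (pow_le_pow_left₀ (norm_nonneg _) (norm_fst_le_pair u) 2) hV.bound_nonneg

lemma norm_energyForm_le (hV : IsBoundedPotential V M) (u v : L2Pair d) :
    ‖energyForm V u v‖ ≤ (d + M) * ‖u‖ * ‖v‖ := by
  have hM := hV.bound_nonneg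
  rw [Real.norm_eq_abs]
  refine abs_le_of_sq_le_sq ?_ (by positivity)
  refine (energyFormOn_sq_le hV subset_rfl u v).trans ?_
  calc _ ≤ ((d + M) * ‖u‖ ^ 2) * ((d + M) * ‖v‖ ^ 2) :=
        mul_le_mul (energyForm_self_le hV u) (energyForm_self_le hV v)
          (energyFormOn_self_nonneg hV _ v) (by positivity)
    _ = _ := by ring

/-- The energy form as a continuous bilinear form. -/
noncomputable def energyCLM (hV : IsBoundedPotential V M) : L2Pair d →L[ℝ] L2Pair d →L[ℝ] ℝ :=
  (energyBilin hV (subset_rfl : unitCube d ⊆ unitCube d)).mkContinuous₂ (d + M)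
    (norm_energyForm_le hV)

@[simp] lemma energyCLM_apply (hV : IsBoundedPotential V M) (u v : L2Pair d) :
    energyCLM hV u v = energyForm V u v := rfl

/-- The norm of a pair is the maximum of its component norms, and the energy already dominates each
derivative component. Coercivity thus reduces to an `L²` bound on the function itself. -/
lemma norm_sq_le_of_norm_fst_sq_le (hV : IsBoundedPotential V M) {C : ℝ} (hC : 1 ≤ C)
    {u : L2Pair d} (h : ‖u.1‖ ^ 2 ≤ C * energyForm V u u) :
    ‖u‖ ^ 2 ≤ C * energyForm V u u := by
  have h0 : 0 ≤ energyForm V u u := energyFormOn_self_nonneg hV _ u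
  have h1 : ‖u‖ ≤ √(C * energyForm V u u) := by
    refine norm_prod_le_iff.2 ⟨Real.le_sqrt_of_sq_le h, ?_⟩
    refine (pi_norm_le_iff_of_nonneg (Real.sqrt_nonneg _)).2 fun i => Real.le_sqrt_of_sq_le ?_
    refine le_trans ?_ (le_mul_of_one_le_left h0 hC)
    rw [energyForm_self_eq hV]
    have := Finset.single_le_sum (f := fun i => ‖u.2 i‖ ^ 2) (fun i _ => sq_nonneg _)
      (Finset.mem_univ i)
    linarith [integral_potential_nonneg hV u.1]
  calc ‖u‖ ^ 2 ≤ √(C * energyForm V u u) ^ 2 := pow_le_pow_left₀ (norm_nonneg _) h1 2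
    _ = _ := Real.sq_sqrt (by positivity)

end EnergyForm

/-! ### The piecewise constant potential -/

section Potential

variable {d N : ℕ}

lemma measurable_cellOf : Measurable (cellOf (d := d) N) := by
  refine measurable_pi_lambda _ fun i => ?_
  have h1 : Measurable fun x : Fin d → ℝ => ⌊(N : ℝ) * x i⌋ :=
    Int.measurable_floor.comp ((measurable_pi_apply i).const_mul _)
  exact (measurable_from_top (f := fun n : ℤ => (n : ZMod N))).comp h1

lemma cellOf_add_int (x : Fin d → ℝ) (k : Fin d → ℤ) :
    cellOf N (fun i => x i + k i) = cellOf N x := by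
  ext i
  have : (N : ℝ) * (x i + k i) = N * x i + ((N * k i : ℤ) : ℝ) := by push_cast; ring
  simp only [cellOf, this, Int.floor_add_intCast]
  simp

lemma cellOf_add_div [NeZero N] (x : Fin d → ℝ) (j : Fin d → ℤ) :
    cellOf N (fun i => x i + j i / N) = fun i => cellOf N x i + (j i : ZMod N) := by
  ext i
  have hN : (N : ℝ) ≠ 0 := NeZero.ne _
  have : (N : ℝ) * (x i + j i / N) = N * x i + (j i : ℤ) := by field_simp
  simp only [cellOf, this, Int.floor_add_intCast, Int.cast_add]

lemma isBoundedPotential_potential (Tβ : Set (Index d N)) [NeZero N] {α β : ℝ} (hα : 0 ≤ α)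
    (hαβ : α ≤ β) : IsBoundedPotential (potential Tβ α β) β where
  measurable := Measurable.ite (measurable_cellOf (Set.toFinite Tβ).measurableSet)
    measurable_const measurable_const
  nonneg x := by unfold potential; split_ifs <;> linarith
  le x := by unfold potential; split_ifs <;> linarith

end Potential

/-! ### Coercive symmetric forms and subspace corrections -/

section Abstract

variable {X : Type*} [NormedAddCommGroup X] [NormedSpace ℝ X]

/-- The Riesz representation theorem for a coercive symmetric form on a Banach space. -/
theorem exists_form_eq_of_coercive [CompleteSpace X] (B : X →L[ℝ] X →L[ℝ] ℝ)
    (hsymm : ∀ x y, B x y = B y x) {c : ℝ} (hc : 0 < c) (hB : ∀ x, c * ‖x‖ ^ 2 ≤ B x x)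
    (l : X →L[ℝ] ℝ) : ∃ x, ∀ y, B x y = l y := by
  -- The solution is found as the minimiser of the energy functional `J`; no inner product norm on
  -- `X` is needed.
  let J : X → ℝ := fun x => B x x - 2 * l x
  have hJ : Continuous J := by fun_prop
  have hbdd : BddBelow (Set.range J) := by
    refine ⟨-(‖l‖ ^ 2 / c), ?_⟩
    rintro _ ⟨x, rfl⟩
    have h1 : l x ≤ ‖l‖ * ‖x‖ := (le_abs_self _).trans (l.le_opNorm x)
    have h2 : -(‖l‖ ^ 2 / c) ≤ c * ‖x‖ ^ 2 - 2 * (‖l‖ * ‖x‖) := by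
      rw [neg_le_iff_add_nonneg]
      have : c * ‖x‖ ^ 2 - 2 * (‖l‖ * ‖x‖) + ‖l‖ ^ 2 / c = (c * ‖x‖ - ‖l‖) ^ 2 / c := by
        field_simp; ring
      rw [this]; positivity
    have := hB x
    simp only [J]; linarith
  set m := ⨅ x, J x
  have hm : ∀ x, m ≤ J x := fun x => ciInf_le hbdd x
  have hex : ∀ n : ℕ, ∃ x, J x < m + 1 / ((n : ℝ) + 1) := fun n =>
    exists_lt_of_ciInf_lt (lt_add_of_pos_right _ Nat.one_div_pos_of_nat)
  choose x hx using hex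
  -- Parallelogram identity: `B(x - y, x - y) = 2 (J x + J y - 2 J((x + y)/2))`, so a minimising
  -- sequence is Cauchy.
  have hpar : ∀ n k, c * ‖x n - x k‖ ^ 2 ≤ 2 * (1 / ((n : ℝ) + 1)) + 2 * (1 / ((k : ℝ) + 1)) := by
    intro n k
    have h1 := hB (x n - x k)
    have h2 := hm ((1 / 2 : ℝ) • (x n + x k))
    have h3 := hx n
    have h4 := hx k
    have h5 := hsymm (x n) (x k)
    simp only [J, map_sub, map_add, map_smul, sub_apply,
      add_apply, smul_apply, smul_eq_mul] at h1 h2 h3 h4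
    linarith
  have hcau : CauchySeq x := by
    refine Metric.cauchySeq_iff'.2 fun e he => ?_
    obtain ⟨n0, hn0⟩ := exists_nat_one_div_lt (show 0 < c * e ^ 2 / 4 by positivity)
    refine ⟨n0, fun n hn => ?_⟩
    have h1 := hpar n n0
    have h2 : 1 / ((n : ℝ) + 1) ≤ 1 / ((n0 : ℝ) + 1) := Nat.one_div_le_one_div hn
    have h3 : c * ‖x n - x n0‖ ^ 2 < c * e ^ 2 := by linarith
    rw [dist_eq_norm]
    exact lt_of_pow_lt_pow_left₀ 2 he.le (lt_of_mul_lt_mul_left h3 hc.le)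
  obtain ⟨z, hz⟩ := cauchySeq_tendsto_of_complete hcau
  have hzm : J z ≤ m := by
    have h1 : Filter.Tendsto (fun n => J (x n)) Filter.atTop (nhds (J z)) :=
      (hJ.tendsto z).comp hz
    have h2 : Filter.Tendsto (fun n : ℕ => m + 1 / ((n : ℝ) + 1)) Filter.atTop (nhds (m + 0)) :=
      tendsto_const_nhds.add tendsto_one_div_add_atTop_nhds_zero_nat
    rw [add_zero] at h2
    exact le_of_tendsto_of_tendsto' h1 h2 fun n => (hx n).le
  refine ⟨z, fun y => ?_⟩
  -- `J(z + t y) - J z` is a nonnegative quadratic in `t` without constant term, so its linear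
  -- coefficient must vanish.
  have hquad : ∀ t : ℝ, 0 ≤ B y y * (t * t) + (2 * (B z y - l y)) * t + 0 := by
    intro t
    have h1 := hm (z + t • y)
    have h2 := hsymm z y
    simp only [J, map_add, map_smul, add_apply,
      smul_apply, smul_eq_mul] at h1 hzm
    rw [← h2] at h1
    linarith
  have hdisc := discrim_le_zero hquad
  simp only [discrim, mul_zero, sub_zero] at hdisc
  have := pow_eq_zero_iff (two_ne_zero) |>.1 (le_antisymm hdisc (sq_nonneg _))
  linarith

/-- The solution operator of a coercive symmetric form on a Banach space. -/
theorem exists_solution_operator [CompleteSpace X] (B : X →L[ℝ] X →L[ℝ] ℝ)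
    (hsymm : ∀ x y, B x y = B y x) {c : ℝ} (hc : 0 < c) (hB : ∀ x, c * ‖x‖ ^ 2 ≤ B x x) :
    ∃ G : (X →L[ℝ] ℝ) →L[ℝ] X, ∀ l y, B (G l) y = l y := by
  have hinj : B.ker = ⊥ := by
    refine LinearMap.ker_eq_bot'.2 fun u hu => ?_
    have h1 : B u u = 0 := by
      have : B u = 0 := hu
      rw [this]; rfl
    have h2 := hB u
    rw [h1] at h2
    have h3 : ‖u‖ ^ 2 ≤ 0 := by
      by_contra hlt
      have := mul_pos hc (not_le.1 hlt)
      linarith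
    exact norm_eq_zero.1 (pow_eq_zero_iff two_ne_zero |>.1 (le_antisymm h3 (sq_nonneg _)))
  have hsurj : B.range = ⊤ := by
    refine LinearMap.range_eq_top.2 fun l => ?_
    obtain ⟨x, hx⟩ := exists_form_eq_of_coercive B hsymm hc hB l
    exact ⟨x, ContinuousLinearMap.ext hx⟩
  -- The bounded inverse theorem makes the solution operator continuous.
  let e := ContinuousLinearEquiv.ofBijective B hinj hsurj
  refine ⟨(e.symm : (X →L[ℝ] ℝ) →L[ℝ] X), fun l y => ?_⟩
  have h1 : B (e.symm l) = l := e.apply_symm_apply l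
  exact congrArg (fun l : X →L[ℝ] ℝ => l y) h1

/-- The projection onto a closed subspace that is orthogonal for a form coercive on it. -/
theorem exists_form_projection [CompleteSpace X] (B : X →L[ℝ] X →L[ℝ] ℝ)
    (hsymm : ∀ x y, B x y = B y x) (K : Submodule ℝ X) (hK : IsClosed (K : Set X)) {c : ℝ}
    (hc : 0 < c) (hB : ∀ x ∈ K, c * ‖x‖ ^ 2 ≤ B x x) :
    ∃ P : X →L[ℝ] X, ∀ u, P u ∈ K ∧ ∀ v ∈ K, B (P u) v = B u v := by
  have : CompleteSpace K := hK.completeSpace_coe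
  obtain ⟨R, hR⟩ : ∃ R : X →L[ℝ] K →L[ℝ] ℝ, ∀ u (v : K), R u v = B u v :=
    ⟨(ContinuousLinearMap.compL ℝ K X ℝ).flip K.subtypeL ∘L B, fun u v => rfl⟩
  obtain ⟨A, hA⟩ : ∃ A : K →L[ℝ] K →L[ℝ] ℝ, ∀ u v : K, A u v = B u v :=
    ⟨R ∘L K.subtypeL, fun u v => hR u v⟩
  obtain ⟨G, hG⟩ := exists_solution_operator A (fun x y => by rw [hA, hA, hsymm]) hc
    (fun x => by rw [hA]; exact hB x x.2)
  -- Restrict the functional `B u` to `K` and solve there. The composition is continuous in `u`,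
  -- which the density argument for the lower spectral bound requires.
  refine ⟨K.subtypeL ∘L G ∘L R, fun u => ⟨Subtype.coe_prop _, fun v hv => ?_⟩⟩
  have h := hG (R u) ⟨v, hv⟩
  rwa [hA, hR] at h

end Abstract

/-! ### Additive subspace corrections: contraction and stable decompositions. -/

section SubspaceCorrection

variable {X ι : Type*} [AddCommGroup X] [Module ℝ X] [Fintype ι]

/-- The error propagation of an additive subspace correction method with spectral bounds `1 / K₁`
and `K₂` is a contraction. -/
theorem subspace_correction_contraction (B : LinearMap.BilinForm ℝ X) (hsymm : ∀ x y, B x y = B y x)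
    (hpos : ∀ x, 0 ≤ B x x) (P : ι → X →ₗ[ℝ] X)
    (hP : ∀ z u v, B (P z u) (P z v) = B u (P z v)) {k₁ k₂ : ℝ} (h₁ : 0 < k₁) (h₂ : 0 < k₂)
    (hlow : ∀ v, B v v ≤ k₁ * ∑ z, B (P z v) (P z v))
    (hup : ∀ v, ∑ z, B (P z v) (P z v) ≤ k₂ * B v v) (v : X) :
    √(B (v - (1 / (k₂ + k₁⁻¹)) • ∑ z, P z v) (v - (1 / (k₂ + k₁⁻¹)) • ∑ z, P z v)) ≤
      k₂ / (k₁⁻¹ + k₂) * √(B v v) := by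
  set θ := 1 / (k₂ + k₁⁻¹) with hθ
  set γ := k₂ / (k₁⁻¹ + k₂) with hγ
  have hk : 0 < k₁⁻¹ := inv_pos.2 h₁
  have hθ0 : 0 < θ := by positivity
  have hγ0 : 0 < γ := by positivity
  let T : X →ₗ[ℝ] X := LinearMap.id - θ • ∑ z, P z
  have hT : ∀ v, T v = v - θ • ∑ z, P z v := fun v => by simp [T]
  have hBT : ∀ u v, B (T u) v = B u v - θ * ∑ z, B (P z u) v := fun u v => by
    rw [hT]; simp [LinearMap.sum_apply]
  have hPs : ∀ z u v, B (P z u) v = B (P z u) (P z v) := fun z u v => by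
    rw [hsymm (P z u) (P z v), hP, hsymm]
  have hTs : ∀ u v, B (T u) v = B (T v) u := fun u v => by
    rw [hBT, hBT, hsymm u v]
    congr 2
    exact Finset.sum_congr rfl fun z _ => by rw [hPs, hsymm, ← hPs]
  have hTself : ∀ u, B (T u) u = B u u - θ * ∑ z, B (P z u) (P z u) := fun u => by
    rw [hBT]
    simp only [← hPs]
  -- The damping is chosen so that `θ k₂ ≤ 1`, hence `T` is positive semidefinite, while `1 - θ
  -- k₁⁻¹` is exactly `γ`.
  have hTpos : ∀ u, 0 ≤ B (T u) u := fun u => by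
    rw [hTself]
    have : θ * ∑ z, B (P z u) (P z u) ≤ θ * (k₂ * B u u) :=
      mul_le_mul_of_nonneg_left (hup u) hθ0.le
    have h3 : θ * k₂ ≤ 1 := by
      rw [hθ, one_div, inv_mul_le_iff₀ (by positivity)]; linarith
    have := mul_le_mul_of_nonneg_right h3 (hpos u)
    linarith
  have hTle : ∀ u, B (T u) u ≤ γ * B u u := fun u => by
    rw [hTself]
    have h3 : θ * (k₁⁻¹ * B u u) ≤ θ * ∑ z, B (P z u) (P z u) :=
      mul_le_mul_of_nonneg_left (by rw [inv_mul_le_iff₀ h₁]; exact hlow u) hθ0.le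
    have h4 : γ = 1 - θ * k₁⁻¹ := by
      rw [hγ, hθ]; field_simp; ring
    rw [h4]; linarith
  -- Cauchy-Schwarz for the semidefinite form `B(T·, ·)` at `v` and `T v` upgrades `0 ≤ B(T·, ·) ≤ γ
  -- B` to a norm bound: `B(Tv,Tv)² ≤ B(Tv,v) B(TTv,Tv) ≤ γ B(v,v) · γ B(Tv,Tv)`.
  let BT : LinearMap.BilinForm ℝ X := B.compLeft T
  have hCS := BT.apply_sq_le_of_symm hTpos ⟨fun u v => hTs u v |>.trans rfl⟩ v (T v)
  have hCS' : B (T v) (T v) ^ 2 ≤ B (T v) v * B (T (T v)) (T v) := hCS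
  have h5 : B (T v) (T v) ≤ γ ^ 2 * B v v := by
    by_cases h0 : B (T v) (T v) = 0
    · rw [h0]; exact mul_nonneg (sq_nonneg _) (hpos v)
    · have hp : 0 < B (T v) (T v) := lt_of_le_of_ne (hpos _) (Ne.symm h0)
      have h6 : B (T v) (T v) ^ 2 ≤ (γ * B v v) * (γ * B (T v) (T v)) :=
        hCS'.trans (mul_le_mul (hTle v) (hTle _) (hTpos _)
          (mul_nonneg hγ0.le (hpos v)))
      have h7 : B (T v) (T v) * B (T v) (T v) ≤ (γ ^ 2 * B v v) * B (T v) (T v) := by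
        linarith
      exact le_of_mul_le_mul_right h7 hp
  rw [← hT]
  calc √(B (T v) (T v)) ≤ √(γ ^ 2 * B v v) := Real.sqrt_le_sqrt h5
    _ = γ * √(B v v) := by rw [Real.sqrt_mul (sq_nonneg _), Real.sqrt_sq hγ0.le]

/-- Lions' lemma: stable decompositions bound the sum of the local energies from below. -/
theorem form_self_le_of_stable_decomposition (B : LinearMap.BilinForm ℝ X)
    (hsymm : ∀ x y, B x y = B y x) (hpos : ∀ x, 0 ≤ B x x) {v : X} (w p : ι → X)
    (hsum : ∑ z, w z = v) (hwp : ∀ z, B (p z) (w z) = B v (w z)) {k : ℝ} (hk : 0 ≤ k)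
    (hw : ∑ z, B (w z) (w z) ≤ k * B v v) : B v v ≤ k * ∑ z, B (p z) (p z) := by
  have h1 : B v v = ∑ z, B (p z) (w z) := by
    simp only [hwp]; rw [← map_sum, hsum]
  -- weighted Young inequality
  have h2 : ∀ z, 2 * (k * B (p z) (w z)) ≤ k ^ 2 * B (p z) (p z) + B (w z) (w z) := fun z => by
    have := hpos (k • p z - w z)
    simp only [map_sub, map_smul, LinearMap.sub_apply, LinearMap.smul_apply, smul_eq_mul] at this
    rw [hsymm (w z) (p z)] at this
    linarith
  have h3 := Finset.sum_le_sum fun z (_ : z ∈ Finset.univ) => h2 z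
  rw [Finset.sum_add_distrib, ← Finset.mul_sum, ← Finset.mul_sum, ← Finset.mul_sum, ← h1] at h3
  -- The summed inequality gives `k B(v,v) ≤ k² ∑ B(p z, p z)`, and one divides by `k`. For `k = 0`
  -- all `w z` have zero energy, and Cauchy-Schwarz makes `B(v,v)` vanish.
  rcases hk.eq_or_lt with rfl | hk'
  · have h4 : ∀ z, B (w z) (w z) = 0 := fun z => by
      have h5 : ∑ z, B (w z) (w z) = 0 :=
        le_antisymm (by simpa using hw) (Finset.sum_nonneg fun z _ => hpos _)
      exact (Finset.sum_eq_zero_iff_of_nonneg fun z _ => hpos _).1 h5 z (Finset.mem_univ z)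
    have h6 : ∀ z, B (p z) (w z) = 0 := fun z => by
      have := B.apply_sq_le_of_symm hpos ⟨fun u v => hsymm u v⟩ (p z) (w z)
      rw [h4, mul_zero] at this
      exact pow_eq_zero_iff two_ne_zero |>.1 (le_antisymm this (sq_nonneg _))
    rw [h1]; simp [h6]
  · have h4 : k * B v v ≤ k * (k * ∑ z, B (p z) (p z)) := by nlinarith
    exact le_of_mul_le_mul_left h4 hk'

end SubspaceCorrection

/-! ### Periodic functions -/

section Periodic

variable {d : ℕ}

/-- The half-open and the open cube differ by a null set, so fundamental domain results for `ℤ^d`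
apply to integrals over `D`. -/
lemma restrict_fundamentalDomain (d : ℕ) :
    volume.restrict (ZSpan.fundamentalDomain (Pi.basisFun ℝ (Fin d))) = cubeMeasure d := by
  have : unitCube d = Set.univ.pi fun _ => Set.Ioo (0 : ℝ) 1 := by
    ext x; simp [unitCube, Set.mem_pi]
  rw [cubeMeasure, this, ZSpan.fundamentalDomain_pi_basisFun]
  exact Measure.restrict_congr_set
    ((Measure.univ_pi_Ico_ae_eq_Icc (μ := fun _ : Fin d => (volume : Measure ℝ))
        (f := fun _ => 0) (g := fun _ => 1)).trans
      (Measure.univ_pi_Ioo_ae_eq_Icc (μ := fun _ : Fin d => (volume : Measure ℝ))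
        (f := fun _ => 0) (g := fun _ => 1)).symm)

lemma exists_int_eq_of_mem_span (v : Submodule.span ℤ (Set.range (Pi.basisFun ℝ (Fin d)))) :
    ∃ k : Fin d → ℤ, ∀ i, (v : Fin d → ℝ) i = k i := by
  have h := (Module.Basis.mem_span_iff_repr_mem ℤ (Pi.basisFun ℝ (Fin d)) v).1 v.2
  choose k hk using h
  exact ⟨k, fun i => by simpa using (hk i).symm⟩

/-- Integrals of periodic functions over the unit cube are invariant under translations. -/
lemma integral_cube_add {g : (Fin d → ℝ) → ℝ} (hg : IsPeriodic g) (h : Fin d → ℝ) :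
    ∫ x, g (x + h) ∂(cubeMeasure d) = ∫ x, g x ∂(cubeMeasure d) := by
  have hF := ZSpan.isAddFundamentalDomain (Pi.basisFun ℝ (Fin d)) volume
  have : VAddCommClass (Fin d → ℝ)
      (Submodule.span ℤ (Set.range (Pi.basisFun ℝ (Fin d)))) (Fin d → ℝ) :=
    ⟨fun a b c => add_left_comm a (b : Fin d → ℝ) c⟩
  have : MeasurableConstVAdd
      (Submodule.span ℤ (Set.range (Pi.basisFun ℝ (Fin d)))) (Fin d → ℝ) :=
    ⟨fun c => measurable_const_add (c : Fin d → ℝ)⟩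
  have : VAddInvariantMeasure
      (Submodule.span ℤ (Set.range (Pi.basisFun ℝ (Fin d)))) (Fin d → ℝ) volume :=
    ⟨fun c s hs => (measurePreserving_add_left volume (c : Fin d → ℝ)).measure_preimage
      hs.nullMeasurableSet⟩
  -- The translated cube is again a fundamental domain, and an invariant function has the same
  -- integral over both.
  have hF' := hF.vadd_of_comm h
  have hper : ∀ (v : Submodule.span ℤ (Set.range (Pi.basisFun ℝ (Fin d)))) (x : Fin d → ℝ),
      g (v +ᵥ x) = g x := fun v x => by
    obtain ⟨k, hk⟩ := exists_int_eq_of_mem_span v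
    rw [← hg x k]
    congr 1; ext i
    change (v : Fin d → ℝ) i + x i = _
    rw [hk, add_comm]
  rw [← restrict_fundamentalDomain, hF.setIntegral_eq hF' hper]
  have hmp := measurePreserving_vadd h (volume : Measure (Fin d → ℝ))
  have := hmp.setIntegral_image_emb (measurableEmbedding_const_vadd h) g
    (ZSpan.fundamentalDomain (Pi.basisFun ℝ (Fin d)))
  change _ = ∫ x in (fun x => h +ᵥ x) '' _, g x
  rw [this]
  simp only [vadd_eq_add, add_comm h]

lemma ae_bound_of_continuous {g : (Fin d → ℝ) → ℝ} (hg : Continuous g) :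
    ∃ C, ∀ x ∈ unitCube d, ‖g x‖ ≤ C := by
  obtain ⟨C, hC⟩ := (isCompact_Icc (a := (0 : Fin d → ℝ)) (b := 1)).exists_bound_of_continuousOn
    hg.continuousOn
  exact ⟨C, fun x hx => hC x ⟨fun i => (hx i).1.le, fun i => (hx i).2.le⟩⟩

lemma memLp_of_continuous {g : (Fin d → ℝ) → ℝ} (hg : Continuous g) (p : ENNReal) :
    MemLp g p (cubeMeasure d) := by
  obtain ⟨C, hC⟩ := ae_bound_of_continuous hg
  exact MemLp.of_bound hg.aestronglyMeasurable C
    ((ae_restrict_iff' (measurableSet_unitCube d)).2 (.of_forall hC))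

lemma integrable_of_continuous {g : (Fin d → ℝ) → ℝ} (hg : Continuous g) :
    Integrable g (cubeMeasure d) :=
  memLp_one_iff_integrable.1 (memLp_of_continuous hg 1)

/-- The `i`-th partial derivative. -/
noncomputable def partialDeriv (i : Fin d) (φ : (Fin d → ℝ) → ℝ) (x : Fin d → ℝ) : ℝ :=
  fderiv ℝ φ x (Pi.single i 1)

lemma continuous_partialDeriv {φ : (Fin d → ℝ) → ℝ} (hφ : ContDiff ℝ ∞ φ) (i : Fin d) :
    Continuous (partialDeriv i φ) :=
  (hφ.continuous_fderiv (by simp)).clm_apply continuous_const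

lemma isPeriodic_partialDeriv {φ : (Fin d → ℝ) → ℝ} (hφ : IsPeriodic φ) (i : Fin d) :
    IsPeriodic (partialDeriv i φ) := fun x k => by
  have h : (fun y => φ (y + fun i => (k i : ℝ))) = φ := funext fun y => hφ y k
  have := fderiv_comp_add_right (𝕜 := ℝ) (f := φ) (x := x) (fun i => (k i : ℝ))
  rw [h] at this
  change fderiv ℝ φ (x + fun i => (k i : ℝ)) _ = _
  rw [← this]; rfl

lemma fderiv_apply_eq_sum (φ : (Fin d → ℝ) → ℝ) (x h : Fin d → ℝ) :
    fderiv ℝ φ x h = ∑ i, h i * partialDeriv i φ x := by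
  conv_lhs => rw [pi_eq_sum_univ' h, map_sum]
  refine Finset.sum_congr rfl fun i _ => ?_
  rw [map_smul, smul_eq_mul, partialDeriv]

/-- A smooth function with its partial derivatives as an element of `L2Pair d`. -/
noncomputable def smoothPair {φ : (Fin d → ℝ) → ℝ} (hφ : ContDiff ℝ ∞ φ) : L2Pair d :=
  ((memLp_of_continuous hφ.continuous 2).toLp φ,
    fun i => (memLp_of_continuous (continuous_partialDeriv hφ i) 2).toLp (partialDeriv i φ))

lemma smoothPair_fst {φ : (Fin d → ℝ) → ℝ} (hφ : ContDiff ℝ ∞ φ) :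
    (smoothPair hφ).1 =ᵐ[cubeMeasure d] φ :=
  (memLp_of_continuous hφ.continuous 2).coeFn_toLp

lemma smoothPair_snd {φ : (Fin d → ℝ) → ℝ} (hφ : ContDiff ℝ ∞ φ) (i : Fin d) :
    (smoothPair hφ).2 i =ᵐ[cubeMeasure d] partialDeriv i φ :=
  (memLp_of_continuous (continuous_partialDeriv hφ i) 2).coeFn_toLp

lemma smoothPair_mem {φ : (Fin d → ℝ) → ℝ} (hφ : ContDiff ℝ ∞ φ) (hper : IsPeriodic φ)
    {U : Set (Fin d → ℝ)} (hU : tsupport φ ⊆ U) : smoothPair hφ ∈ smoothPairs U :=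
  ⟨φ, hφ, hper, hU, smoothPair_fst hφ, smoothPair_snd hφ⟩

lemma exists_smoothPair_eq {U : Set (Fin d → ℝ)} {p : L2Pair d} (hp : p ∈ smoothPairs U) :
    ∃ (φ : (Fin d → ℝ) → ℝ) (hφ : ContDiff ℝ ∞ φ), IsPeriodic φ ∧ tsupport φ ⊆ U ∧
      p = smoothPair hφ := by
  obtain ⟨φ, hφ, hper, hU, h1, h2⟩ := hp
  refine ⟨φ, hφ, hper, hU, Prod.ext (Lp.ext (h1.trans (smoothPair_fst hφ).symm)) ?_⟩
  exact funext fun i => Lp.ext ((h2 i).trans (smoothPair_snd hφ i).symm)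

lemma energyForm_smoothPair (V : (Fin d → ℝ) → ℝ) {φ : (Fin d → ℝ) → ℝ}
    (hφ : ContDiff ℝ ∞ φ) :
    energyForm V (smoothPair hφ) (smoothPair hφ) =
      ∫ x, ((∑ i, partialDeriv i φ x ^ 2) + V x * φ x ^ 2) ∂(cubeMeasure d) := by
  refine integral_congr_ae ?_
  filter_upwards [smoothPair_fst hφ, ae_all_iff.2 (smoothPair_snd hφ)] with x h1 h2
  simp only [h1, h2]
  congr 1
  · exact Finset.sum_congr rfl fun i _ => by ring
  · ring

lemma norm_fst_smoothPair_sq {φ : (Fin d → ℝ) → ℝ} (hφ : ContDiff ℝ ∞ φ) :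
    ‖(smoothPair hφ).1‖ ^ 2 = ∫ x, φ x ^ 2 ∂(cubeMeasure d) := by
  rw [← real_inner_self_eq_norm_sq, ← integral_mul_L2]
  refine integral_congr_ae ?_
  filter_upwards [smoothPair_fst hφ] with x h1
  rw [h1, sq]

/-- Expand the variance `∫ (g - m)² ≥ 0` about the mean `m`. -/
lemma sq_integral_le {g : ℝ → ℝ} (hg : Continuous g) :
    (∫ t in (0 : ℝ)..1, g t) ^ 2 ≤ ∫ t in (0 : ℝ)..1, g t ^ 2 := by
  set m := ∫ t in (0 : ℝ)..1, g t with hm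
  have h1 : 0 ≤ ∫ t in (0 : ℝ)..1, (g t - m) ^ 2 :=
    intervalIntegral.integral_nonneg zero_le_one fun t _ => sq_nonneg _
  have h2 : ∫ t in (0 : ℝ)..1, (g t - m) ^ 2 =
      (∫ t in (0 : ℝ)..1, g t ^ 2) - ∫ t in (0 : ℝ)..1, (2 * m * g t - m ^ 2) := by
    rw [← intervalIntegral.integral_sub
      (Continuous.intervalIntegrable (by fun_prop) _ _)
      (Continuous.intervalIntegrable (by fun_prop) _ _)]
    congr 1; ext t; ring
  rw [h2, intervalIntegral.integral_sub (by apply Continuous.intervalIntegrable; fun_prop)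
    (by simp), intervalIntegral.integral_const_mul, ← hm] at h1
  simp at h1
  nlinarith

/-- The translation estimate `‖φ(· + h) - φ‖ ≤ |h| ‖∇φ‖` on the torus. -/
lemma integral_translate_sub_sq_le {φ : (Fin d → ℝ) → ℝ} (hφ : ContDiff ℝ ∞ φ)
    (hper : IsPeriodic φ) (h : Fin d → ℝ) :
    ∫ x, (φ (x + h) - φ x) ^ 2 ∂(cubeMeasure d) ≤
      (∑ i, h i ^ 2) * ∫ x, ∑ i, partialDeriv i φ x ^ 2 ∂(cubeMeasure d) := by
  set G : (Fin d → ℝ) → ℝ := fun x => (∑ i, h i ^ 2) * ∑ i, partialDeriv i φ x ^ 2 with hG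
  have hGc : Continuous G :=
    continuous_const.mul (continuous_finsetSum _ fun i _ => (continuous_partialDeriv hφ i).pow 2)
  have hGper : IsPeriodic G := fun x k => by
    simp only [hG, isPeriodic_partialDeriv hper _ x k]
  -- Fundamental theorem of calculus along the segment from `x` to `x + h`, then Cauchy-Schwarz in
  -- `t` and in the coordinates.
  have hpt : ∀ x, (φ (x + h) - φ x) ^ 2 ≤ ∫ t in (0 : ℝ)..1, G (x + t • h) := by
    intro x
    have hd : ∀ t : ℝ, HasDerivAt (fun t : ℝ => φ (x + t • h)) (fderiv ℝ φ (x + t • h) h) t := by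
      intro t
      have h1 : HasDerivAt (fun t : ℝ => x + t • h) h t := by
        simpa using ((hasDerivAt_id t).smul_const h).const_add x
      exact ((hφ.differentiable (by simp) (x + t • h)).hasFDerivAt).comp_hasDerivAt t h1
    have hc : Continuous fun t : ℝ => fderiv ℝ φ (x + t • h) h :=
      ((hφ.continuous_fderiv (by simp)).comp (by fun_prop)).clm_apply continuous_const
    have hft := intervalIntegral.integral_eq_sub_of_hasDerivAt (a := 0) (b := 1)
      (fun t _ => hd t) (hc.intervalIntegrable _ _)
    simp only [one_smul, zero_smul, add_zero] at hft
    rw [← hft]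
    refine (sq_integral_le hc).trans ?_
    refine intervalIntegral.integral_mono zero_le_one ((hc.pow 2).intervalIntegrable _ _)
      ((hGc.comp (by fun_prop)).intervalIntegrable _ _) fun t => ?_
    simp only [hG]
    rw [fderiv_apply_eq_sum]
    exact Finset.sum_mul_sq_le_sq_mul_sq _ _ _
  -- Boundedness of `G`, needed for Fubini, follows by moving every point into the closed unit cube
  -- by periodicity.
  have hGb : ∃ C, ∀ x, ‖G x‖ ≤ C := by
    obtain ⟨C, hC⟩ := (isCompact_Icc (a := (0 : Fin d → ℝ))
      (b := 1)).exists_bound_of_continuousOn hGc.continuousOn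
    refine ⟨C, fun x => ?_⟩
    have := hGper x fun i => -⌊x i⌋
    rw [← this]
    refine hC _ ⟨fun i => ?_, fun i => ?_⟩
    · have := Int.floor_le (x i); simp; linarith
    · have := Int.lt_floor_add_one (x i); simp; linarith
  obtain ⟨C, hC⟩ := hGb
  have hint : Integrable (Function.uncurry fun (x : Fin d → ℝ) (t : ℝ) => G (x + t • h))
      ((cubeMeasure d).prod (volume.restrict (Set.Ioc (0 : ℝ) 1))) :=
    Integrable.of_bound (C := C) (Continuous.aestronglyMeasurable (by
      unfold Function.uncurry; exact hGc.comp (by fun_prop))) (.of_forall fun p => hC _)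
  have hswap : ∫ x, (∫ t in (0 : ℝ)..1, G (x + t • h)) ∂(cubeMeasure d) =
      ∫ t in (0 : ℝ)..1, (∫ x, G (x + t • h) ∂(cubeMeasure d)) := by
    simp only [intervalIntegral.integral_of_le zero_le_one]
    exact integral_integral_swap hint
  have hcont : Continuous fun x => (φ (x + h) - φ x) ^ 2 :=
    ((hφ.continuous.comp (by fun_prop)).sub hφ.continuous).pow 2
  calc ∫ x, (φ (x + h) - φ x) ^ 2 ∂(cubeMeasure d)
      ≤ ∫ x, (∫ t in (0 : ℝ)..1, G (x + t • h)) ∂(cubeMeasure d) := by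
        refine integral_mono (integrable_of_continuous hcont) ?_ hpt
        simp only [intervalIntegral.integral_of_le zero_le_one]
        exact hint.integral_prod_left
    _ = ∫ x, G x ∂(cubeMeasure d) := by
        -- After the swap the inner integral does not depend on `t`, by translation invariance.
        rw [hswap]
        simp only [integral_cube_add hGper]
        simp
    _ = _ := by rw [hG, integral_const_mul]

end Periodic

/-! ### Valley cubes -/

section Valleys

variable {d N : ℕ}

/-- Offsets below `m ≤ N` stay distinct modulo `N`. The cell count therefore determines the side
length, which allows widths to be compared by cardinality. -/
lemma ncard_cubeCells (c : Index d N) {m : ℕ} (hm : m ≤ N) : (cubeCells c m).ncard = m ^ d := by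
  let F : (Fin d → Fin m) → Index d N := fun j i => c i + ((j i : ℕ) : ZMod N)
  have hF : cubeCells c m = Set.range F := by
    ext q
    constructor
    · rintro ⟨j, hj, hq⟩
      exact ⟨fun i => ⟨j i, hj i⟩, funext fun i => (hq i).symm⟩
    · rintro ⟨j, rfl⟩
      exact ⟨fun i => j i, fun i => (j i).2, fun i => rfl⟩
  have hinj : Function.Injective F := fun j k h => by
    funext i
    have h1 := add_left_cancel (congrFun h i)
    rw [ZMod.natCast_eq_natCast_iff', Nat.mod_eq_of_lt ((j i).2.trans_le hm),
      Nat.mod_eq_of_lt ((k i).2.trans_le hm)] at h1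
    exact Fin.ext h1
  rw [hF, ← Set.image_univ, Set.ncard_image_of_injective _ hinj, Set.ncard_univ]
  simp

lemma mem_cubeCells_self (c : Index d N) {m : ℕ} (hm : 1 ≤ m) : c ∈ cubeCells c m :=
  ⟨fun _ => 0, fun _ => hm, fun i => by simp⟩

lemma exists_isMaximalCube_superset [NeZero N] {T Q : Set (Index d N)} (hQ : IsMeshCube Q) (hQT : Q ⊆ T) :
    ∃ Q', IsMaximalCube T Q' ∧ Q ⊆ Q' := by
  obtain ⟨Q', hle, hmax⟩ := (Set.toFinite {Q : Set (Index d N) | IsMeshCube Q ∧ Q ⊆ T}).exists_le_maximal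
    (show Q ∈ _ from ⟨hQ, hQT⟩)
  refine ⟨Q', ⟨hmax.1.1, hmax.1.2, fun R hR hle' hRT => ?_⟩, hle⟩
  exact (hmax.2 ⟨hR, hRT⟩ hle').antisymm hle'

/-- By finiteness the cube extends to a maximal one, and comparing `m ^ d` with `m' ^ d` compares
the widths. The bound by `N` keeps the supremum over `ℕ` meaningful. -/
lemma le_valleyWidth [NeZero N] (hd : d ≠ 0) {Tβ : Set (Index d N)} {c : Index d N} {m : ℕ} (hm : 1 ≤ m)
    (hmN : m ≤ N) (h : cubeCells c m ⊆ Tβᶜ) : m ≤ valleyWidth Tβ := by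
  have hne : Tβᶜ ≠ ∅ := fun h0 => by
    have := h (mem_cubeCells_self c hm)
    rw [h0] at this; exact this
  obtain ⟨Q, hQ, hle⟩ := exists_isMaximalCube_superset ⟨c, m, hm, hmN, rfl⟩ h
  obtain ⟨c', m', h1, h2, rfl⟩ := hQ.1
  have hcard := Set.ncard_le_ncard hle (Set.toFinite _)
  rw [ncard_cubeCells c hmN, ncard_cubeCells c' h2] at hcard
  have hmm : m ≤ m' := (Nat.pow_le_pow_iff_left hd).1 hcard
  rw [valleyWidth, if_neg hne]
  exact hmm.trans (le_csSup ⟨N, fun _ hk => hk.2.1⟩ ⟨h1, h2, c', hQ⟩)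

lemma one_le_valleyWidth [NeZero N] (hd : d ≠ 0) (Tβ : Set (Index d N)) : 1 ≤ valleyWidth Tβ := by
  by_cases hne : Tβᶜ = ∅
  · simp [valleyWidth, hne]
  · obtain ⟨q, hq⟩ := Set.nonempty_iff_ne_empty.2 hne
    refine le_valleyWidth hd (c := q) le_rfl (NeZero.one_le) ?_
    rintro p ⟨j, hj, hp⟩
    have : p = q := funext fun i => by
      have : j i = 0 := by have := hj i; omega
      rw [hp i, this]; simp
    rwa [this]

lemma one_le_valleyOverlap [NeZero N] (Tβ : Set (Index d N)) : 1 ≤ valleyOverlap Tβ := by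
  by_cases hne : Tβᶜ = ∅
  · simp [valleyOverlap, hne]
  · obtain ⟨q, hq⟩ := Set.nonempty_iff_ne_empty.2 hne
    rw [valleyOverlap, if_neg hne]
    have hbdd : BddAbove {n | ∃ q ∈ Tβᶜ, n = {Q | IsMaximalCube Tβᶜ Q ∧ q ∈ Q}.ncard} := by
      refine ((Set.toFinite (Set.range fun q : Index d N =>
        {Q | IsMaximalCube Tβᶜ Q ∧ q ∈ Q}.ncard)).subset ?_).bddAbove
      rintro _ ⟨q, -, rfl⟩
      exact ⟨q, rfl⟩
    refine le_trans ?_ (le_csSup hbdd ⟨q, hq, rfl⟩)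
    have hsub : cubeCells q 1 ⊆ Tβᶜ := by
      rintro p ⟨j, hj, hp⟩
      have : p = q := funext fun i => by
        have : j i = 0 := by have := hj i; omega
        rw [hp i, this]; simp
      rwa [this]
    obtain ⟨Q, hQ, hle⟩ := exists_isMaximalCube_superset ⟨q, 1, le_rfl, NeZero.one_le, rfl⟩ hsub
    exact (Set.ncard_pos (Set.toFinite _)).2 ⟨Q, hQ, hle (mem_cubeCells_self q le_rfl)⟩

/-- From every cell, a cell of `Tβ` is reached by a shift of at most `L` cells in each coordinate
direction. -/
lemma exists_shift_mem [NeZero N] (hd : d ≠ 0) {Tβ : Set (Index d N)} (hT : Tβ.Nonempty) (q : Index d N) :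
    ∃ j : Fin d → Fin (valleyWidth Tβ + 1), (fun i => q i + (((j i : ℕ) : ℤ) : ZMod N)) ∈ Tβ := by
  by_contra! hno
  have hsub : cubeCells q (valleyWidth Tβ + 1) ⊆ Tβᶜ := by
    rintro p ⟨j, hj, hp⟩
    have : p = fun i => q i + (((j i : ℕ) : ℤ) : ZMod N) := funext fun i => by
      rw [hp i, Int.cast_natCast]
    rw [this]
    exact hno fun i => ⟨j i, hj i⟩
  -- If `L < N`, a valley cube of side `L + 1` contradicts the definition of `L`. If `L ≥ N`, the
  -- cube covers the whole torus, so it meets `Tβ`.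
  rcases Nat.lt_or_ge (valleyWidth Tβ) N with h | h
  · have := le_valleyWidth hd (Nat.le_add_left 1 _) h hsub
    omega
  · obtain ⟨p, hp⟩ := hT
    refine hsub ⟨fun i => (p i - q i).val, fun i => ?_, fun i => ?_⟩ hp
    · exact (ZMod.val_lt (p i - q i)).trans_le (h.trans (Nat.le_succ _))
    · rw [ZMod.natCast_zmod_val]; ring

end Valleys

/-! ### The Friedrichs inequality and coercivity -/

section Friedrichs

variable {d N : ℕ}

lemma isPeriodic_potential (Tβ : Set (Index d N)) (α β : ℝ) : IsPeriodic (potential Tβ α β) :=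
  fun x k => by unfold potential; rw [cellOf_add_int]

lemma integrable_potential_mul_translate {V : (Fin d → ℝ) → ℝ} {M : ℝ}
    (hV : IsBoundedPotential V M) {g : (Fin d → ℝ) → ℝ} (hg : Continuous g) (h : Fin d → ℝ) :
    Integrable (fun x => V (x + h) * g x) (cubeMeasure d) :=
  (integrable_of_continuous hg).bdd_mul (c := M)
    (hV.measurable.comp (measurable_id.add_const h)).aestronglyMeasurable
    (.of_forall fun x => by rw [Real.norm_of_nonneg (hV.nonneg _)]; exact hV.le _)

lemma energyForm_smoothPair_eq_add {V : (Fin d → ℝ) → ℝ} {M : ℝ} (hV : IsBoundedPotential V M)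
    {φ : (Fin d → ℝ) → ℝ} (hφ : ContDiff ℝ ∞ φ) :
    energyForm V (smoothPair hφ) (smoothPair hφ) =
      (∫ x, ∑ i, partialDeriv i φ x ^ 2 ∂(cubeMeasure d)) +
        ∫ x, V x * φ x ^ 2 ∂(cubeMeasure d) := by
  rw [energyForm_smoothPair, integral_add]
  · exact integrable_of_continuous
      (continuous_finsetSum _ fun i _ => (continuous_partialDeriv hφ i).pow 2)
  · simpa using integrable_potential_mul_translate hV (hφ.continuous.pow 2) 0

/-- The constant of the Friedrichs inequality, up to a factor depending only on `d` and `c₀`. -/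
noncomputable def valleyFactor (Tβ : Set (Index d N)) : ℝ :=
  ((valleyOverlap Tβ : ℝ) * (valleyWidth Tβ : ℝ) ^ d) ^ 2 * (valleyWidth Tβ : ℝ) ^ 2

lemma valleyFactor_nonneg (Tβ : Set (Index d N)) : 0 ≤ valleyFactor Tβ := by
  unfold valleyFactor; positivity

/-- The shift argument produces `L^(d+2)`; since `κ` and `L` are at least `1`, the prescribed factor
dominates it. -/
lemma pow_valleyWidth_le_valleyFactor [NeZero N] (hd : d ≠ 0) (Tβ : Set (Index d N)) :
    (valleyWidth Tβ : ℝ) ^ d * (valleyWidth Tβ : ℝ) ^ 2 ≤ valleyFactor Tβ := by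
  have hL : (1 : ℝ) ≤ valleyWidth Tβ := by exact_mod_cast one_le_valleyWidth hd Tβ
  have hκ : (1 : ℝ) ≤ valleyOverlap Tβ := by exact_mod_cast one_le_valleyOverlap Tβ
  have h1 : (1 : ℝ) ≤ (valleyWidth Tβ : ℝ) ^ d := one_le_pow₀ hL
  refine mul_le_mul_of_nonneg_right ?_ (by positivity)
  nlinarith [mul_le_mul hκ le_rfl (zero_le_one.trans h1) (zero_le_one.trans hκ)]

/-- Some shift `h j` moves `x` into a cell of `Tβ`, and `φ(x)² ≤ 2 φ(x + h j)² + 2 (φ(x + h j) -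
φ(x))²`. The good `j` depends on `x`, so the right side is summed over all `(L+1)^d` shifts before
integrating. Translation invariance turns the first terms into the potential energy. The translation
estimate bounds the second by `|h j|² ≤ d L² / N²` times the gradient energy. Finally `(L+1)^d ≤ 2^d
L^d`. -/
lemma friedrichs_smooth [NeZero N] (hd : d ≠ 0) {c₀ : ℝ} (hc₀ : 0 < c₀) {Tβ : Set (Index d N)}
    {α β : ℝ} (hT : Tβ.Nonempty) (hα : 0 ≤ α) (hαβ : α ≤ β) (hβ : c₀ * (N : ℝ) ^ 2 ≤ β)
    {φ : (Fin d → ℝ) → ℝ} (hφ : ContDiff ℝ ∞ φ) (hper : IsPeriodic φ) :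
    (N : ℝ) ^ 2 * ∫ x, φ x ^ 2 ∂(cubeMeasure d) ≤
      2 ^ (d + 1) * (1 / c₀ + d) * valleyFactor Tβ *
        energyForm (potential Tβ α β) (smoothPair hφ) (smoothPair hφ) := by
  set V := potential Tβ α β with hVdef
  have hV : IsBoundedPotential V β := isBoundedPotential_potential Tβ hα hαβ
  set L := valleyWidth Tβ with hL
  have hN : (0 : ℝ) < N := Nat.cast_pos.2 (NeZero.pos N)
  have hL1 : (1 : ℝ) ≤ L := by exact_mod_cast one_le_valleyWidth hd Tβ
  set I := ∫ x, φ x ^ 2 ∂(cubeMeasure d) with hI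
  set E := ∫ x, V x * φ x ^ 2 ∂(cubeMeasure d) with hE
  set G := ∫ x, ∑ i, partialDeriv i φ x ^ 2 ∂(cubeMeasure d) with hG
  have hE0 : 0 ≤ E := integral_nonneg fun x => mul_nonneg (hV.nonneg x) (sq_nonneg _)
  have hG0 : 0 ≤ G := integral_nonneg fun x => Finset.sum_nonneg fun i _ => sq_nonneg _
  let h : (Fin d → Fin (L + 1)) → Fin d → ℝ := fun j i => ((j i : ℕ) : ℤ) / N
  have hpt : ∀ x, c₀ * (N : ℝ) ^ 2 * φ x ^ 2 ≤
      ∑ j, (2 * (V (x + h j) * φ (x + h j) ^ 2) +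
        2 * (c₀ * (N : ℝ) ^ 2) * (φ (x + h j) - φ x) ^ 2) := by
    intro x
    obtain ⟨j, hj⟩ := exists_shift_mem hd hT (cellOf N x)
    have hVj : V (x + h j) = β := by
      have : cellOf N (x + h j) ∈ Tβ := by
        have := cellOf_add_div (N := N) x fun i => ((j i : ℕ) : ℤ)
        change cellOf N (x + h j) = _ at this
        rw [this]; exact hj
      rw [hVdef, potential, if_pos this]
    refine le_trans ?_ (Finset.single_le_sum
      (f := fun j => 2 * (V (x + h j) * φ (x + h j) ^ 2) +
        2 * (c₀ * (N : ℝ) ^ 2) * (φ (x + h j) - φ x) ^ 2)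
      (fun j _ => add_nonneg (mul_nonneg zero_le_two (mul_nonneg (hV.nonneg _) (sq_nonneg _)))
        (by positivity)) (Finset.mem_univ j))
    simp only [hVj]
    have h1 : c₀ * (N : ℝ) ^ 2 * φ (x + h j) ^ 2 ≤ β * φ (x + h j) ^ 2 :=
      mul_le_mul_of_nonneg_right hβ (sq_nonneg _)
    have h2 : φ x ^ 2 ≤ 2 * φ (x + h j) ^ 2 + 2 * (φ (x + h j) - φ x) ^ 2 := by
      nlinarith [sq_nonneg (2 * φ (x + h j) - φ x)]
    have h3 := mul_le_mul_of_nonneg_left h2 (show 0 ≤ c₀ * (N : ℝ) ^ 2 by positivity)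
    linarith
  have hVint : ∀ j, Integrable (fun x => V (x + h j) * φ (x + h j) ^ 2) (cubeMeasure d) :=
    fun j => integrable_potential_mul_translate hV
      ((hφ.continuous.comp (continuous_id.add continuous_const)).pow 2) (h j)
  have hDint : ∀ j, Integrable (fun x => (φ (x + h j) - φ x) ^ 2) (cubeMeasure d) :=
    fun j => integrable_of_continuous
      (((hφ.continuous.comp (continuous_id.add continuous_const)).sub hφ.continuous).pow 2)
  have hsum : ∀ j, Integrable (fun x => 2 * (V (x + h j) * φ (x + h j) ^ 2) +
      2 * (c₀ * (N : ℝ) ^ 2) * (φ (x + h j) - φ x) ^ 2) (cubeMeasure d) :=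
    fun j => ((hVint j).const_mul 2).add ((hDint j).const_mul _)
  have hVφ : IsPeriodic fun x => V x * φ x ^ 2 := fun x k => by
    simp only [hper x k, isPeriodic_potential Tβ α β x k, hVdef]
  have hh : ∀ j, (N : ℝ) ^ 2 * ∑ i, h j i ^ 2 ≤ d * (L : ℝ) ^ 2 := by
    intro j
    rw [Finset.mul_sum]
    refine (Finset.sum_le_card_nsmul _ _ ((L : ℝ) ^ 2) fun i _ => ?_).trans (by simp)
    have : (N : ℝ) ^ 2 * h j i ^ 2 = ((j i : ℕ) : ℝ) ^ 2 := by
      simp only [h, Int.cast_natCast]; field_simp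
    rw [this]
    have hle : ((j i : ℕ) : ℝ) ≤ L := by exact_mod_cast Nat.lt_succ_iff.1 (j i).2
    exact pow_le_pow_left₀ (by positivity) hle 2
  have hmain : c₀ * (N : ℝ) ^ 2 * I ≤
      ((L : ℝ) + 1) ^ d * (2 * E + 2 * c₀ * (d * (L : ℝ) ^ 2 * G)) := by
    calc c₀ * (N : ℝ) ^ 2 * I
        = ∫ x, c₀ * (N : ℝ) ^ 2 * φ x ^ 2 ∂(cubeMeasure d) := (integral_const_mul _ _).symm
      _ ≤ ∫ x, ∑ j, (2 * (V (x + h j) * φ (x + h j) ^ 2) +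
            2 * (c₀ * (N : ℝ) ^ 2) * (φ (x + h j) - φ x) ^ 2) ∂(cubeMeasure d) :=
          integral_mono ((integrable_of_continuous (hφ.continuous.pow 2)).const_mul _)
            (integrable_finsetSum _ fun j _ => hsum j) hpt
      _ = ∑ j, (2 * E + 2 * (c₀ * (N : ℝ) ^ 2) *
            ∫ x, (φ (x + h j) - φ x) ^ 2 ∂(cubeMeasure d)) := by
          rw [integral_finsetSum _ fun j _ => hsum j]
          refine Finset.sum_congr rfl fun j _ => ?_
          rw [integral_add ((hVint j).const_mul 2) ((hDint j).const_mul _), integral_const_mul,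
            integral_const_mul, integral_cube_add hVφ (h j)]
      _ ≤ ∑ j : Fin d → Fin (L + 1), (2 * E + 2 * c₀ * (d * (L : ℝ) ^ 2 * G)) := by
          refine Finset.sum_le_sum fun j _ => add_le_add le_rfl ?_
          have h1 := integral_translate_sub_sq_le hφ hper (h j)
          have h2 := mul_le_mul_of_nonneg_right (hh j) hG0
          have h3 : (N : ℝ) ^ 2 * ∫ x, (φ (x + h j) - φ x) ^ 2 ∂(cubeMeasure d) ≤
              d * (L : ℝ) ^ 2 * G := by
            refine (mul_le_mul_of_nonneg_left h1 (sq_nonneg _)).trans ?_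
            rw [← mul_assoc]; exact h2
          have := mul_le_mul_of_nonneg_left h3 (show 0 ≤ 2 * c₀ by positivity)
          linarith
      _ = _ := by simp; ring
  have hfac := pow_valleyWidth_le_valleyFactor hd Tβ
  rw [energyForm_smoothPair_eq_add hV hφ, ← hG, ← hE]
  have hL2 : (1 : ℝ) ≤ (L : ℝ) ^ 2 := one_le_pow₀ hL1
  have h2L : ((L : ℝ) + 1) ^ d ≤ 2 ^ d * (L : ℝ) ^ d := by
    rw [← mul_pow]; exact pow_le_pow_left₀ (by positivity) (by linarith) d
  have h4 : (N : ℝ) ^ 2 * I ≤ ((L : ℝ) + 1) ^ d * (2 * (1 / c₀) * E + 2 * (d * (L : ℝ) ^ 2 * G)) := by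
    refine le_of_mul_le_mul_left ?_ hc₀
    rw [← mul_assoc]
    refine hmain.trans (le_of_eq ?_)
    field_simp
  have h5 : 2 * (1 / c₀) * E + 2 * (d * (L : ℝ) ^ 2 * G) ≤
      2 * ((1 / c₀ + d) * (L : ℝ) ^ 2 * (G + E)) := by
    have e1 : 0 ≤ 1 / c₀ * ((L : ℝ) ^ 2 - 1) * E := by
      have : 0 ≤ (L : ℝ) ^ 2 - 1 := by linarith
      positivity
    have e2 : 0 ≤ 1 / c₀ * (L : ℝ) ^ 2 * G := by positivity
    have e3 : 0 ≤ (d : ℝ) * (L : ℝ) ^ 2 * E := by positivity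
    linarith
  calc (N : ℝ) ^ 2 * I
      ≤ ((L : ℝ) + 1) ^ d * (2 * (1 / c₀) * E + 2 * (d * (L : ℝ) ^ 2 * G)) := h4
    _ ≤ (2 ^ d * (L : ℝ) ^ d) * (2 * ((1 / c₀ + d) * (L : ℝ) ^ 2 * (G + E))) :=
        mul_le_mul h2L h5 (by positivity) (by positivity)
    _ = 2 ^ (d + 1) * (1 / c₀ + d) * ((L : ℝ) ^ d * (L : ℝ) ^ 2) * (G + E) := by ring
    _ ≤ _ := by gcongr

/-- Inequalities between continuous functions extend from smooth functions to their closure. -/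
lemma le_of_mem_closure_smoothPairs {U : Set (Fin d → ℝ)} {F G : L2Pair d → ℝ}
    (hF : Continuous F) (hG : Continuous G) (h : ∀ u ∈ smoothPairs U, F u ≤ G u)
    {u : L2Pair d} (hu : u ∈ (smoothPairs U).topologicalClosure) : F u ≤ G u :=
  closure_minimal (s := (smoothPairs U : Set (L2Pair d))) (t := {u | F u ≤ G u}) h
    (isClosed_le hF hG) hu

lemma continuous_energyForm_self {V : (Fin d → ℝ) → ℝ} {M : ℝ} (hV : IsBoundedPotential V M) :
    Continuous fun u : L2Pair d => energyForm V u u := by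
  have : Continuous fun u : L2Pair d => energyCLM hV u u := by fun_prop
  exact this

lemma friedrichs [NeZero N] (hd : d ≠ 0) {c₀ : ℝ} (hc₀ : 0 < c₀) {Tβ : Set (Index d N)}
    {α β : ℝ} (hT : Tβ.Nonempty) (hα : 0 ≤ α) (hαβ : α ≤ β) (hβ : c₀ * (N : ℝ) ^ 2 ≤ β)
    {u : L2Pair d} (hu : u ∈ H1per d) :
    (N : ℝ) ^ 2 * ‖u.1‖ ^ 2 ≤
      2 ^ (d + 1) * (1 / c₀ + d) * valleyFactor Tβ * energyForm (potential Tβ α β) u u := by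
  refine le_of_mem_closure_smoothPairs 
    (continuous_const.mul (continuous_fst.norm.pow 2)) (continuous_const.mul
    (continuous_energyForm_self (isBoundedPotential_potential Tβ hα hαβ))) (fun v hv => ?_) hu
  obtain ⟨φ, hφ, hper, -, rfl⟩ := exists_smoothPair_eq hv
  change (N : ℝ) ^ 2 * ‖(smoothPair hφ).1‖ ^ 2 ≤ _ * energyForm _ (smoothPair hφ) (smoothPair hφ)
  rw [norm_fst_smoothPair_sq]
  exact friedrichs_smooth hd hc₀ hT hα hαβ hβ hφ hper

/-- The energy form is coercive on `H¹_per(D)`. -/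
lemma exists_coercive [NeZero N] (hd : d ≠ 0) {c₀ : ℝ} (hc₀ : 0 < c₀) {Tβ : Set (Index d N)}
    {α β : ℝ} (hT : Tβ.Nonempty) (hα : 0 ≤ α) (hαβ : α ≤ β) (hβ : c₀ * (N : ℝ) ^ 2 ≤ β) :
    ∃ c > 0, ∀ u ∈ H1per d, c * ‖u‖ ^ 2 ≤ energyForm (potential Tβ α β) u u := by
  have hV := isBoundedPotential_potential Tβ hα hαβ
  -- The summand `1` ensures `C ≥ 1`, so that `C` times the energy also bounds the derivative
  -- components.
  set C := 1 + 2 ^ (d + 1) * (1 / c₀ + d) * valleyFactor Tβ with hC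
  have h0 : 0 ≤ 2 ^ (d + 1) * (1 / c₀ + d) * valleyFactor Tβ :=
    mul_nonneg (by positivity) (valleyFactor_nonneg Tβ)
  have hC1 : 1 ≤ C := by linarith
  refine ⟨C⁻¹, by positivity, fun u hu => ?_⟩
  rw [inv_mul_le_iff₀ (by positivity)]
  refine norm_sq_le_of_norm_fst_sq_le hV hC1 ?_
  have h1 := friedrichs hd hc₀ hT hα hαβ hβ hu
  have h2 : (1 : ℝ) ≤ (N : ℝ) ^ 2 := one_le_pow₀ (by exact_mod_cast NeZero.one_le)
  have h3 : 0 ≤ energyForm (potential Tβ α β) u u := energyFormOn_self_nonneg hV _ u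
  have h4 := le_mul_of_one_le_left (sq_nonneg ‖u.1‖) h2
  rw [hC, add_mul]; linarith

end Friedrichs

/-! ### A smooth periodic partition of unity subordinate to the patches -/

section PartitionOfUnity

/-- A smooth step from `0` (for `t ≤ 1/4`) to `1` (for `t ≥ 3/4`). -/
noncomputable def smoothStep (t : ℝ) : ℝ := Real.smoothTransition (2 * t - 1 / 2)

lemma contDiff_smoothStep : ContDiff ℝ ∞ smoothStep :=
  Real.smoothTransition.contDiff.comp ((contDiff_const.mul contDiff_id).sub contDiff_const)

lemma smoothStep_eq_zero {t : ℝ} (h : t ≤ 1 / 4) : smoothStep t = 0 :=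
  Real.smoothTransition.zero_of_nonpos (by linarith)

lemma smoothStep_eq_one {t : ℝ} (h : 3 / 4 ≤ t) : smoothStep t = 1 :=
  Real.smoothTransition.one_of_one_le (by linarith)

lemma smoothStep_nonneg (t : ℝ) : 0 ≤ smoothStep t := Real.smoothTransition.nonneg _

lemma smoothStep_le_one (t : ℝ) : smoothStep t ≤ 1 := Real.smoothTransition.le_one _

lemma exists_bound_deriv_smoothStep :
    ∃ M : ℝ, ∀ t ∈ Set.Icc (0 : ℝ) 1, deriv smoothStep t ^ 2 ≤ M := by
  obtain ⟨M, hM⟩ := isCompact_Icc.exists_bound_of_continuousOn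
    (s := Set.Icc (0 : ℝ) 1) ((contDiff_smoothStep.continuous_deriv (by simp)).pow 2).continuousOn
  exact ⟨M, fun t ht => (le_abs_self _).trans (hM t ht)⟩

/-- Smooth interpolation of a function on `ℤ`. -/
noncomputable def smoothInterp (A : ℤ → ℝ) (X : ℝ) : ℝ :=
  A ⌊X⌋ * (1 - smoothStep (Int.fract X)) + A (⌊X⌋ + 1) * smoothStep (Int.fract X)

/-- The step is constant near both ends, so the formula of one mesh interval persists a quarter
beyond it. Hence a single smooth formula is valid near every point, integers included. -/
lemma smoothInterp_eq (A : ℤ → ℝ) (m : ℤ) {X : ℝ} (h1 : (m : ℝ) - 1 / 4 < X)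
    (h2 : X < m + 1 + 1 / 4) :
    smoothInterp A X = A m * (1 - smoothStep (X - m)) + A (m + 1) * smoothStep (X - m) := by
  rcases lt_or_ge X m with h | h
  · have hf : ⌊X⌋ = m - 1 := Int.floor_eq_iff.2 ⟨by push_cast; linarith, by push_cast; linarith⟩
    rw [smoothInterp, Int.fract, hf, smoothStep_eq_zero (t := X - m) (by linarith),
      smoothStep_eq_one (by push_cast; linarith)]
    simp
  · rcases lt_or_ge X (m + 1) with h' | h'
    · have hf : ⌊X⌋ = m := Int.floor_eq_iff.2 ⟨h, h'⟩
      rw [smoothInterp, Int.fract, hf]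
    · have hf : ⌊X⌋ = m + 1 :=
        Int.floor_eq_iff.2 ⟨by push_cast; linarith, by push_cast; linarith⟩
      rw [smoothInterp, Int.fract, hf, smoothStep_eq_one (t := X - m) (by linarith),
        smoothStep_eq_zero (by push_cast; linarith)]
      simp

lemma smoothInterp_eventuallyEq (A : ℤ → ℝ) (X : ℝ) :
    smoothInterp A =ᶠ[nhds X] fun Y =>
      A ⌊X⌋ * (1 - smoothStep (Y - ⌊X⌋)) + A (⌊X⌋ + 1) * smoothStep (Y - ⌊X⌋) := by
  have h1 := Int.floor_le X
  have h2 := Int.lt_floor_add_one X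
  filter_upwards [Ioo_mem_nhds (show (⌊X⌋ : ℝ) - 1 / 4 < X by linarith)
    (show X < ⌊X⌋ + 1 + 1 / 4 by linarith)] with Y hY
  exact smoothInterp_eq A _ hY.1 hY.2

lemma contDiff_smoothInterp (A : ℤ → ℝ) : ContDiff ℝ ∞ (smoothInterp A) := by
  refine contDiff_iff_contDiffAt.2 fun X => ?_
  refine ContDiffAt.congr_of_eventuallyEq ?_ (smoothInterp_eventuallyEq A X)
  have h : ContDiff ℝ ∞ fun Y => smoothStep (Y - ⌊X⌋) :=
    contDiff_smoothStep.comp (contDiff_id.sub contDiff_const)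
  exact ((contDiff_const.mul (contDiff_const.sub h)).add (contDiff_const.mul h)).contDiffAt

lemma deriv_smoothInterp (A : ℤ → ℝ) (X : ℝ) :
    deriv (smoothInterp A) X = (A (⌊X⌋ + 1) - A ⌊X⌋) * deriv smoothStep (Int.fract X) := by
  rw [(smoothInterp_eventuallyEq A X).deriv_eq]
  have h0 : HasDerivAt smoothStep (deriv smoothStep (X - ⌊X⌋)) (X - ⌊X⌋) :=
    (contDiff_smoothStep.differentiable (by simp) _).hasDerivAt
  have h : HasDerivAt (fun Y => smoothStep (Y - ⌊X⌋)) (deriv smoothStep (X - ⌊X⌋)) X :=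
    h0.comp_sub_const X _
  refine ((h.const_sub 1 |>.const_mul (A ⌊X⌋)).add (h.const_mul (A (⌊X⌋ + 1)))).deriv.trans ?_
  rw [Int.fract]
  ring

variable {d N : ℕ}

/-- The smooth periodic hat function of the node `c` of the one-dimensional mesh. -/
noncomputable def hat (c : ZMod N) (t : ℝ) : ℝ :=
  smoothInterp (fun k => if (k : ZMod N) = c then 1 else 0) (N * t)

lemma contDiff_hat (c : ZMod N) : ContDiff ℝ ∞ (hat c) :=
  (contDiff_smoothInterp _).comp (contDiff_const.mul contDiff_id)

lemma hat_add_int (c : ZMod N) (t : ℝ) (k : ℤ) : hat c (t + k) = hat c t := by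
  have h : (N : ℝ) * (t + k) = N * t + ((N * k : ℤ) : ℝ) := by push_cast; ring
  rw [hat, hat, h, smoothInterp, smoothInterp, Int.floor_add_intCast, Int.fract_add_intCast]
  simp

lemma hat_nonneg (c : ZMod N) (t : ℝ) : 0 ≤ hat c t := by
  have h1 := smoothStep_nonneg (Int.fract (N * t))
  have h2 := sub_nonneg.2 (smoothStep_le_one (Int.fract (N * t)))
  unfold hat smoothInterp
  refine add_nonneg (mul_nonneg ?_ h2) (mul_nonneg ?_ h1) <;> dsimp only <;> split_ifs <;> norm_num

lemma sum_hat [NeZero N] (t : ℝ) : ∑ c : ZMod N, hat c t = 1 := by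
  simp only [hat, smoothInterp, Finset.sum_add_distrib, ← Finset.sum_mul, Finset.sum_ite_eq,
    Finset.mem_univ, if_true]
  ring

lemma sum_hat_sq_le [NeZero N] (t : ℝ) : ∑ c : ZMod N, hat c t ^ 2 ≤ 1 := by
  rw [← sum_hat (N := N) t]
  refine Finset.sum_le_sum fun c _ => ?_
  have h : hat c t ≤ 1 := by
    rw [← sum_hat (N := N) t]
    exact Finset.single_le_sum (fun c _ => hat_nonneg c t) (Finset.mem_univ c)
  nlinarith [hat_nonneg c t]

/-- The radius `3/4`, smaller than `1`, leaves the margin that keeps closed supports inside the open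
patch. -/
lemma exists_of_hat_ne_zero {c : ZMod N} {t : ℝ} (h : hat c t ≠ 0) :
    ∃ y : ℤ, (y : ZMod N) = c ∧ |(N : ℝ) * t - y| ≤ 3 / 4 := by
  have h1 := Int.fract_nonneg ((N : ℝ) * t)
  have h2 := Int.fract_lt_one ((N : ℝ) * t)
  have h3 := Int.self_sub_floor ((N : ℝ) * t)
  by_contra! hno
  refine h ?_
  unfold hat smoothInterp
  have e1 : (if ((⌊(N : ℝ) * t⌋ : ℤ) : ZMod N) = c then (1 : ℝ) else 0) *
      (1 - smoothStep (Int.fract (N * t))) = 0 := by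
    split_ifs with hc
    · have := hno _ hc
      rw [h3, abs_of_nonneg h1] at this
      rw [smoothStep_eq_one this.le]; simp
    · simp
  have e2 : (if ((⌊(N : ℝ) * t⌋ + 1 : ℤ) : ZMod N) = c then (1 : ℝ) else 0) *
      smoothStep (Int.fract (N * t)) = 0 := by
    split_ifs with hc
    · have := hno _ hc
      have e3 : (N : ℝ) * t - ((⌊(N : ℝ) * t⌋ + 1 : ℤ) : ℝ) = Int.fract (N * t) - 1 := by
        push_cast; rw [← h3]; ring
      rw [e3, abs_of_nonpos (by linarith)] at this
      rw [smoothStep_eq_zero (by linarith)]; simp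
    · simp
  rw [e1, e2, add_zero]

lemma deriv_hat (c : ZMod N) (t : ℝ) :
    deriv (hat c) t =
      N * deriv (smoothInterp (fun k => if (k : ZMod N) = c then 1 else 0)) (N * t) := by
  have h := ((contDiff_smoothInterp (fun k => if (k : ZMod N) = c then 1 else 0)).differentiable
    (by simp) (N * t)).hasDerivAt
  have h1 : HasDerivAt (fun t : ℝ => (N : ℝ) * t) N t := by
    simpa using (hasDerivAt_id t).const_mul (N : ℝ)
  have := (h.comp t h1).deriv
  rw [mul_comm]; exact this

/-- Only the classes of `⌊N t⌋` and `⌊N t⌋ + 1` contribute, each at most `N² M`; the two indicators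
also cover the case where the classes coincide. -/
lemma sum_deriv_hat_sq_le [NeZero N] {M : ℝ}
    (hM : ∀ t ∈ Set.Icc (0 : ℝ) 1, deriv smoothStep t ^ 2 ≤ M) (t : ℝ) :
    ∑ c : ZMod N, deriv (hat c) t ^ 2 ≤ 2 * M * (N : ℝ) ^ 2 := by
  set m := ⌊(N : ℝ) * t⌋ with hm
  have hs := hM (Int.fract (N * t)) ⟨Int.fract_nonneg _, (Int.fract_lt_one _).le⟩
  set D := deriv smoothStep (Int.fract (N * t)) ^ 2
  have hD : 0 ≤ D := sq_nonneg _
  have h : ∀ c : ZMod N, deriv (hat c) t ^ 2 ≤ (N : ℝ) ^ 2 * D *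
      ((if ((m + 1 : ℤ) : ZMod N) = c then 1 else 0) + (if (m : ZMod N) = c then 1 else 0)) := by
    intro c
    rw [deriv_hat, deriv_smoothInterp, ← hm, mul_pow, mul_pow, mul_comm (_ ^ 2) D, ← mul_assoc]
    refine mul_le_mul_of_nonneg_left ?_ (by positivity)
    split_ifs <;> norm_num
  refine (Finset.sum_le_sum fun c _ => h c).trans ?_
  rw [← Finset.mul_sum, Finset.sum_add_distrib, Finset.sum_ite_eq, Finset.sum_ite_eq]
  simp only [Finset.mem_univ, if_true]
  nlinarith [mul_le_mul_of_nonneg_left hs (sq_nonneg (N : ℝ))]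

/-- The smooth periodic bump function of the node `z`. -/
noncomputable def bump (z : Index d N) (x : Fin d → ℝ) : ℝ := ∏ i, hat (z i) (x i)

lemma contDiff_bump (z : Index d N) : ContDiff ℝ ∞ (bump z) :=
  contDiff_prod fun i _ => (contDiff_hat (z i)).comp (contDiff_apply ℝ ℝ i)

lemma isPeriodic_bump (z : Index d N) : IsPeriodic (bump z) := fun x k => by
  simp only [bump, hat_add_int]

/-- Sums of tensor products over all nodes factor into one-dimensional sums, so the bounds below do
not depend on the number of nodes. -/
lemma sum_prod_index [NeZero N] (F : Fin d → ZMod N → ℝ) :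
    ∑ z : Index d N, ∏ i, F i (z i) = ∏ i, ∑ c, F i c := by
  rw [Finset.prod_univ_sum, Fintype.piFinset_univ]

lemma sum_bump [NeZero N] (x : Fin d → ℝ) : ∑ z : Index d N, bump z x = 1 := by
  simp only [bump, sum_prod_index fun i c => hat c (x i), sum_hat, Finset.prod_const_one]

lemma sum_bump_sq_le [NeZero N] (x : Fin d → ℝ) : ∑ z : Index d N, bump z x ^ 2 ≤ 1 := by
  simp only [bump, ← Finset.prod_pow, sum_prod_index fun i c => hat c (x i) ^ 2]
  exact Finset.prod_le_one (fun i _ => Finset.sum_nonneg fun c _ => sq_nonneg _)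
    fun i _ => sum_hat_sq_le _

lemma partialDeriv_bump (z : Index d N) (i : Fin d) (x : Fin d → ℝ) :
    partialDeriv i (bump z) x =
      ∏ l, if l = i then deriv (hat (z l)) (x l) else hat (z l) (x l) := by
  have h : ∀ l ∈ (Finset.univ : Finset (Fin d)), HasFDerivAt (fun y : Fin d → ℝ => hat (z l) (y l))
      (deriv (hat (z l)) (x l) • (ContinuousLinearMap.proj l : (Fin d → ℝ) →L[ℝ] ℝ)) x :=
    fun l _ => HasDerivAt.comp_hasFDerivAt (h₂ := hat (z l)) x
      ((contDiff_hat (z l)).differentiable (by simp) (x l)).hasDerivAt (hasFDerivAt_apply l x)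
  have h2 := (HasFDerivAt.finsetProd h).fderiv
  have h3 : partialDeriv i (bump z) x =
      fderiv ℝ (fun y : Fin d → ℝ => ∏ l, hat (z l) (y l)) x (Pi.single i 1) := rfl
  rw [h3, h2, ← Finset.mul_prod_erase _ _ (Finset.mem_univ i)]
  simp only [sum_apply, smul_apply, ContinuousLinearMap.proj_apply, smul_eq_mul, if_true]
  rw [Finset.sum_eq_single i (fun l _ hl => by simp [hl]) (by simp)]
  rw [Pi.single_eq_same, mul_one, mul_comm]
  congr 1
  exact Finset.prod_congr rfl fun l hl => by rw [if_neg (Finset.ne_of_mem_erase hl)]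

lemma sum_partialDeriv_bump_sq_le [NeZero N] {M : ℝ}
    (hM : ∀ t ∈ Set.Icc (0 : ℝ) 1, deriv smoothStep t ^ 2 ≤ M) (i : Fin d) (x : Fin d → ℝ) :
    ∑ z : Index d N, partialDeriv i (bump z) x ^ 2 ≤ 2 * M * (N : ℝ) ^ 2 := by
  simp only [partialDeriv_bump, ← Finset.prod_pow]
  rw [sum_prod_index fun l c => (if l = i then deriv (hat c) (x l) else hat c (x l)) ^ 2,
    ← Finset.mul_prod_erase _ _ (Finset.mem_univ i)]
  simp only [if_true]
  refine (mul_le_of_le_one_right (Finset.sum_nonneg fun c _ => sq_nonneg _) ?_).trans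
    (sum_deriv_hat_sq_le hM (x i))
  refine Finset.prod_le_one (fun l _ => Finset.sum_nonneg fun c _ => sq_nonneg _) fun l hl => ?_
  simp only [if_neg (Finset.ne_of_mem_erase hl)]
  exact sum_hat_sq_le _

open scoped Pointwise in
lemma tsupport_bump_mul_subset [NeZero N] (z : Index d N) (φ : (Fin d → ℝ) → ℝ) :
    tsupport (fun x => bump z x * φ x) ⊆ patch z := by
  -- The closed `3/4`-neighbourhood of the integers in the class `z i`: a closed discrete set plus a
  -- compact interval is closed, so taking the closure of the support does not leave it.
  let Y : Fin d → Set ℝ := fun i =>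
    ((fun n : ℤ => (n : ℝ)) '' {y : ℤ | (y : ZMod N) = z i}) + Set.Icc (-(3 / 4)) (3 / 4)
  have hY : ∀ i, IsClosed (Y i) := fun i =>
    (Int.isClosedEmbedding_coe_real.isClosedMap _ (isClosed_discrete _)).add_right_of_isCompact
      isCompact_Icc
  have hC : IsClosed {x : Fin d → ℝ | ∀ i, (N : ℝ) * x i ∈ Y i} := by
    simp only [Set.ofPred_forall]
    exact isClosed_iInter fun i =>
      (hY i).preimage (continuous_const.mul (continuous_apply i))
  have hN : (0 : ℝ) < N := Nat.cast_pos.2 (NeZero.pos N)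
  refine (closure_minimal ?_ hC).trans ?_
  · intro x hx i
    have h1 : bump z x ≠ 0 := left_ne_zero_of_mul hx
    obtain ⟨y, hy, hle⟩ := exists_of_hat_ne_zero (Finset.prod_ne_zero_iff.1 h1 i (Finset.mem_univ i))
    exact ⟨y, ⟨y, hy, rfl⟩, N * x i - y, abs_le.1 hle, by ring⟩
  · intro x hx
    choose a ha b hb hab using hx
    choose y hy hya using ha
    refine ⟨y, hy, fun i => ?_⟩
    have h1 : x i - y i / N = b i / N := by
      have := hab i
      rw [← hya i] at this
      field_simp
      simp only at this
      linarith
    rw [h1, abs_div, abs_of_pos hN]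
    refine div_lt_div_of_pos_right ?_ hN
    have := abs_le.2 (hb i)
    linarith

end PartitionOfUnity

/-! ### The stable decomposition by the partition of unity. -/

section Decomposition

variable {d N : ℕ}

lemma contDiff_bump_mul (z : Index d N) {φ : (Fin d → ℝ) → ℝ} (hφ : ContDiff ℝ ∞ φ) :
    ContDiff ℝ ∞ fun x => bump z x * φ x := (contDiff_bump z).mul hφ

lemma partialDeriv_bump_mul (z : Index d N) {φ : (Fin d → ℝ) → ℝ} (hφ : ContDiff ℝ ∞ φ)
    (i : Fin d) (x : Fin d → ℝ) :
    partialDeriv i (fun x => bump z x * φ x) x =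
      bump z x * partialDeriv i φ x + φ x * partialDeriv i (bump z) x := by
  unfold partialDeriv
  rw [fderiv_fun_mul ((contDiff_bump z).differentiable (by simp) x)
    (hφ.differentiable (by simp) x)]
  rfl

lemma smoothPair_bump_mul_mem [NeZero N] (z : Index d N) {φ : (Fin d → ℝ) → ℝ}
    (hφ : ContDiff ℝ ∞ φ) (hper : IsPeriodic φ) :
    smoothPair (contDiff_bump_mul z hφ) ∈ H10patch z :=
  Submodule.le_topologicalClosure _ (smoothPair_mem _
    (fun x k => by simp only [isPeriodic_bump z x k, hper x k]) (tsupport_bump_mul_subset z φ))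

lemma coeFn_pair_sum {ι : Type*} (s : Finset ι) (w : ι → L2Pair d) :
    ∀ᵐ x ∂(cubeMeasure d), (∑ z ∈ s, w z).1 x = ∑ z ∈ s, (w z).1 x ∧
      ∀ i, (∑ z ∈ s, w z).2 i x = ∑ z ∈ s, (w z).2 i x := by
  classical
  induction s using Finset.induction_on with
  | empty =>
    filter_upwards [Lp.coeFn_zero ℝ 2 (cubeMeasure d)] with x hx
    simp only [Finset.sum_empty]
    exact ⟨hx, fun i => hx⟩
  | insert a s ha ih =>
    filter_upwards [ih, coeFn_pair_add (w a) (∑ z ∈ s, w z)] with x h1 h2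
    simp only [Finset.sum_insert ha]
    exact ⟨by rw [h2.1, h1.1], fun i => by rw [h2.2 i, h1.2 i]⟩

lemma sum_smoothPair_bump_mul [NeZero N] {φ : (Fin d → ℝ) → ℝ} (hφ : ContDiff ℝ ∞ φ) :
    ∑ z : Index d N, smoothPair (contDiff_bump_mul z hφ) = smoothPair hφ := by
  have hfun : (fun x => ∑ z : Index d N, bump z x * φ x) = φ := funext fun x => by
    rw [← Finset.sum_mul, sum_bump, one_mul]
  have hder : ∀ i x, ∑ z : Index d N, partialDeriv i (fun x => bump z x * φ x) x =
      partialDeriv i φ x := fun i x => by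
    conv_rhs => rw [← hfun]
    unfold partialDeriv
    rw [fderiv_fun_sum fun z _ => (contDiff_bump_mul z hφ).differentiable (by simp) x]
    simp
  have hsum := coeFn_pair_sum Finset.univ
    fun z : Index d N => smoothPair (contDiff_bump_mul z hφ)
  have h1 := ae_all_iff.2 fun z : Index d N => smoothPair_fst (contDiff_bump_mul z hφ)
  have h2 := ae_all_iff.2 fun z : Index d N => ae_all_iff.2 fun i =>
    smoothPair_snd (contDiff_bump_mul z hφ) i
  refine Prod.ext (Lp.ext ?_) (funext fun i => Lp.ext ?_)
  · filter_upwards [hsum, h1, smoothPair_fst hφ] with x e1 e2 e3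
    rw [e1.1, e3]
    simp only [e2]
    exact congrFun hfun x
  · filter_upwards [hsum, h2, smoothPair_snd hφ i] with x e1 e2 e3
    rw [e1.2 i, e3, ← hder]
    exact Finset.sum_congr rfl fun z _ => e2 z i

/-- Pointwise product rule with `(a + b)² ≤ 2a² + 2b²`, using `∑ η_z² ≤ 1` and `∑ (∂_i η_z)² ≤
2MN²`. The sum over `d` directions gives `4dM`. -/
lemma sum_energyForm_bump_mul_le [NeZero N] {V : (Fin d → ℝ) → ℝ} {B : ℝ}
    (hV : IsBoundedPotential V B) {M : ℝ}
    (hM : ∀ t ∈ Set.Icc (0 : ℝ) 1, deriv smoothStep t ^ 2 ≤ M)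
    {φ : (Fin d → ℝ) → ℝ} (hφ : ContDiff ℝ ∞ φ) :
    ∑ z : Index d N, energyForm V (smoothPair (contDiff_bump_mul z hφ))
        (smoothPair (contDiff_bump_mul z hφ)) ≤
      2 * energyForm V (smoothPair hφ) (smoothPair hφ) +
        4 * d * M * ((N : ℝ) ^ 2 * ∫ x, φ x ^ 2 ∂(cubeMeasure d)) := by
  have hint : ∀ {ψ : (Fin d → ℝ) → ℝ}, ContDiff ℝ ∞ ψ →
      Integrable (fun x => (∑ i, partialDeriv i ψ x ^ 2) + V x * ψ x ^ 2) (cubeMeasure d) := by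
    intro ψ hψ
    refine Integrable.add (integrable_of_continuous
      (continuous_finsetSum _ fun i _ => (continuous_partialDeriv hψ i).pow 2)) ?_
    simpa using integrable_potential_mul_translate hV (hψ.continuous.pow 2) 0
  have hsq : Integrable (fun x => φ x ^ 2) (cubeMeasure d) :=
    integrable_of_continuous (hφ.continuous.pow 2)
  simp only [energyForm_smoothPair]
  rw [← integral_finsetSum _ fun z _ => hint (contDiff_bump_mul z hφ), ← integral_const_mul,
    ← integral_const_mul, ← integral_const_mul, ← integral_add ((hint hφ).const_mul 2)
      ((hsq.const_mul _).const_mul _)]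
  refine integral_mono (integrable_finsetSum _ fun z _ => hint (contDiff_bump_mul z hφ))
    (((hint hφ).const_mul 2).add
      ((hsq.const_mul _).const_mul _)) fun x => ?_
  have hS := sum_bump_sq_le (N := N) x
  have hgrad : ∀ i, ∑ z : Index d N, partialDeriv i (fun x => bump z x * φ x) x ^ 2 ≤
      2 * partialDeriv i φ x ^ 2 + 4 * M * (N : ℝ) ^ 2 * φ x ^ 2 := by
    intro i
    calc ∑ z : Index d N, partialDeriv i (fun x => bump z x * φ x) x ^ 2
        ≤ ∑ z : Index d N, (2 * partialDeriv i φ x ^ 2 * bump z x ^ 2 +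
            2 * φ x ^ 2 * partialDeriv i (bump z) x ^ 2) := by
          refine Finset.sum_le_sum fun z _ => ?_
          rw [partialDeriv_bump_mul z hφ]
          nlinarith [sq_nonneg (bump z x * partialDeriv i φ x - φ x * partialDeriv i (bump z) x)]
      _ = 2 * partialDeriv i φ x ^ 2 * ∑ z : Index d N, bump z x ^ 2 +
            2 * φ x ^ 2 * ∑ z : Index d N, partialDeriv i (bump z) x ^ 2 := by
          rw [Finset.sum_add_distrib, Finset.mul_sum, Finset.mul_sum]
      _ ≤ 2 * partialDeriv i φ x ^ 2 * 1 + 2 * φ x ^ 2 * (2 * M * (N : ℝ) ^ 2) :=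
          add_le_add (mul_le_mul_of_nonneg_left hS (by positivity))
            (mul_le_mul_of_nonneg_left (sum_partialDeriv_bump_sq_le hM i x) (by positivity))
      _ = _ := by ring
  have hpot : ∑ z : Index d N, V x * (bump z x * φ x) ^ 2 ≤ V x * φ x ^ 2 := by
    have : ∀ z : Index d N, V x * (bump z x * φ x) ^ 2 = V x * φ x ^ 2 * bump z x ^ 2 :=
      fun z => by ring
    simp only [this, ← Finset.mul_sum]
    exact mul_le_of_le_one_right (mul_nonneg (hV.nonneg x) (sq_nonneg _)) hS
  have hVφ : 0 ≤ V x * φ x ^ 2 := mul_nonneg (hV.nonneg x) (sq_nonneg _)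
  have hg := Finset.sum_le_sum fun i (_ : i ∈ (Finset.univ : Finset (Fin d))) => hgrad i
  rw [Finset.sum_add_distrib, ← Finset.mul_sum, Finset.sum_const, Finset.card_univ,
    Fintype.card_fin, nsmul_eq_mul] at hg
  rw [Finset.sum_comm] at hg
  simp only [Finset.sum_add_distrib]
  linarith

end Decomposition

/-! ### Functions vanishing outside a set -/

section Vanishing

variable {d N : ℕ}

/-- The pairs that vanish almost everywhere outside `S`. -/
def vanishingOff (S : Set (Fin d → ℝ)) : Submodule ℝ (L2Pair d) where
  carrier := {u | ∀ᵐ x ∂(cubeMeasure d), x ∉ S → u.1 x = 0 ∧ ∀ i, u.2 i x = 0}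
  zero_mem' := by
    filter_upwards [Lp.coeFn_zero ℝ 2 (cubeMeasure d)] with x hx _
    exact ⟨hx, fun i => hx⟩
  add_mem' := by
    intro u v hu hv
    filter_upwards [hu, hv, coeFn_pair_add u v] with x h1 h2 h3 hx
    rw [h3.1, (h1 hx).1, (h2 hx).1, add_zero]
    exact ⟨rfl, fun i => by rw [h3.2 i, (h1 hx).2 i, (h2 hx).2 i, add_zero]⟩
  smul_mem' := by
    intro c u hu
    filter_upwards [hu, coeFn_pair_smul c u] with x h1 h3 hx
    rw [h3.1, (h1 hx).1, mul_zero]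
    exact ⟨rfl, fun i => by rw [h3.2 i, (h1 hx).2 i, mul_zero]⟩

lemma vanishingOff_mono {S T : Set (Fin d → ℝ)} (h : S ⊆ T) :
    vanishingOff S ≤ vanishingOff T := fun u hu => by
  filter_upwards [show ∀ᵐ x ∂(cubeMeasure d), _ from hu] with x h1 hx
  exact h1 fun hS => hx (h hS)

lemma continuous_energyFormOn_self {V : (Fin d → ℝ) → ℝ} {M : ℝ} (hV : IsBoundedPotential V M)
    {S : Set (Fin d → ℝ)} (hS : S ⊆ unitCube d) :
    Continuous fun u : L2Pair d => energyFormOn V S u u := by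
  have hM := hV.bound_nonneg
  have hbound : ∀ u v : L2Pair d, ‖energyBilin hV hS u v‖ ≤ (d + M) * ‖u‖ * ‖v‖ := fun u v => by
    rw [Real.norm_eq_abs]
    refine abs_le_of_sq_le_sq ?_ (by positivity)
    refine (energyFormOn_sq_le hV hS u v).trans ?_
    calc _ ≤ ((d + M) * ‖u‖ ^ 2) * ((d + M) * ‖v‖ ^ 2) :=
          mul_le_mul ((energyFormOn_self_mono hV hS subset_rfl u).trans (energyForm_self_le hV u))
            ((energyFormOn_self_mono hV hS subset_rfl v).trans (energyForm_self_le hV v))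
            (energyFormOn_self_nonneg hV _ v) (by positivity)
      _ = _ := by ring
  let A := (energyBilin hV hS).mkContinuous₂ _ hbound
  have : Continuous fun u : L2Pair d => A u u := by fun_prop
  exact this

lemma isOpen_patch (z : Index d N) : IsOpen (patch z) := by
  have : patch z = ⋃ y ∈ {y : Fin d → ℤ | ∀ i, (y i : ZMod N) = z i},
      ⋂ i, {x : Fin d → ℝ | |x i - y i / N| < 1 / N} := by
    ext x; simp [patch]
  rw [this]
  refine isOpen_biUnion fun y _ => isOpen_iInter_of_finite fun i => ?_
  exact isOpen_lt (by fun_prop) continuous_const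

/-- The energy outside `U` with potential `1` is continuous and zero on smooth pairs, hence zero on
the closure; its nonnegative density then vanishes almost everywhere there. -/
lemma closure_smoothPairs_le_vanishingOff {U : Set (Fin d → ℝ)} (hU : MeasurableSet U) :
    (smoothPairs U).topologicalClosure ≤ vanishingOff U := by
  intro u hu
  have hV : IsBoundedPotential (fun _ : Fin d → ℝ => (1 : ℝ)) 1 :=
    ⟨measurable_const, fun _ => zero_le_one, fun _ => le_rfl⟩
  have hS : unitCube d \ U ⊆ unitCube d := Set.sdiff_subset
  have hSm : MeasurableSet (unitCube d \ U) := (measurableSet_unitCube d).diff hU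
  have hsmooth : ∀ v ∈ smoothPairs U, energyFormOn (fun _ => 1) (unitCube d \ U) v v ≤ 0 := by
    intro v hv
    obtain ⟨φ, hφ, -, hsupp, rfl⟩ := exists_smoothPair_eq hv
    refine (setIntegral_eq_zero_of_ae_eq_zero ?_).le
    have h1 := (ae_restrict_iff' (measurableSet_unitCube d)).1 (smoothPair_fst hφ)
    have h2 := (ae_restrict_iff' (measurableSet_unitCube d)).1
      (ae_all_iff.2 (smoothPair_snd hφ))
    filter_upwards [h1, h2] with x e1 e2 hx
    have hx' : x ∉ tsupport φ := fun h => hx.2 (hsupp h)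
    have h0 : φ x = 0 := image_eq_zero_of_notMem_tsupport hx'
    have h00 : ∀ i, partialDeriv i φ x = 0 := fun i => by
      rw [partialDeriv, fderiv_of_notMem_tsupport ℝ hx']; rfl
    simp [e1 hx.1, e2 hx.1, h0, h00]
  have h0 : energyFormOn (fun _ => 1) (unitCube d \ U) u u ≤ 0 :=
    le_of_mem_closure_smoothPairs (continuous_energyFormOn_self hV hS) continuous_const hsmooth hu
  have h1 := (setIntegral_eq_zero_iff_of_nonneg_ae
    (.of_forall fun x => energy_density_nonneg hV u x) (hV.integrableOn_energy hS u u)).1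
    (le_antisymm h0 (energyFormOn_self_nonneg hV _ u))
  rw [Filter.EventuallyEq, ae_restrict_iff' hSm] at h1
  refine (ae_restrict_iff' (measurableSet_unitCube d)).2 ?_
  filter_upwards [h1] with x hx hxD hxU
  have h2 := hx ⟨hxD, hxU⟩
  simp only [Pi.zero_apply, one_mul] at h2
  have h3 : 0 ≤ ∑ i, u.2 i x * u.2 i x := Finset.sum_nonneg fun i _ => mul_self_nonneg _
  have h4 := mul_self_nonneg (u.1 x)
  refine ⟨mul_self_eq_zero.1 (by linarith), fun i => mul_self_eq_zero.1 ?_⟩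
  exact (Finset.sum_eq_zero_iff_of_nonneg fun i _ => mul_self_nonneg _).1
    (show ∑ i, u.2 i x * u.2 i x = 0 by linarith) i (Finset.mem_univ i)

lemma H10patch_le_vanishingOff (z : Index d N) : H10patch z ≤ vanishingOff (patch z) :=
  closure_smoothPairs_le_vanishingOff (isOpen_patch z).measurableSet

lemma H10patch_le_H1per (z : Index d N) : H10patch z ≤ H1per d :=
  Submodule.topologicalClosure_mono fun _ ⟨φ, h1, h2, _, h4, h5⟩ =>
    ⟨φ, h1, h2, Set.subset_univ _, h4, h5⟩

lemma energyForm_eq_energyFormOn_of_vanishingOff (V : (Fin d → ℝ) → ℝ) {U : Set (Fin d → ℝ)}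
    {u : L2Pair d} (hu : u ∈ vanishingOff U) (v : L2Pair d) :
    energyForm V u v = energyFormOn V (unitCube d ∩ U) u v := by
  unfold energyForm energyFormOn
  refine (setIntegral_eq_of_subset_of_ae_sdiff_eq_zero
    (measurableSet_unitCube d).nullMeasurableSet Set.inter_subset_left ?_)
  have h := (ae_restrict_iff' (measurableSet_unitCube d)).1 hu
  filter_upwards [h] with x hx hxD
  have := hx hxD.1 fun hU => hxD.2 ⟨hxD.1, hU⟩
  simp [this.1, this.2]

lemma energyForm_eq_zero_of_disjoint (V : (Fin d → ℝ) → ℝ) {U W : Set (Fin d → ℝ)}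
    (hUW : Disjoint U W) {u v : L2Pair d} (hu : u ∈ vanishingOff U) (hv : v ∈ vanishingOff W) :
    energyForm V u v = 0 := by
  refine setIntegral_eq_zero_of_ae_eq_zero ?_
  have h1 := (ae_restrict_iff' (measurableSet_unitCube d)).1 hu
  have h2 := (ae_restrict_iff' (measurableSet_unitCube d)).1 hv
  filter_upwards [h1, h2] with x e1 e2 hx
  by_cases hxU : x ∈ U
  · have := e2 hx (Set.disjoint_left.1 hUW hxU)
    simp [this.1, this.2]
  · have := e1 hx hxU
    simp [this.1, this.2]

end Vanishing

/-! ### Spectral bounds of the subspace correction -/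

section Bounds

variable {d N : ℕ}

lemma abs_sub_lt_one_of_abs_sub_div_lt [NeZero N] {t : ℝ} {y : ℤ} (h : |t - y / N| < 1 / N) :
    |(N : ℝ) * t - y| < 1 := by
  have hN : (0 : ℝ) < N := Nat.cast_pos.2 (NeZero.pos N)
  have h1 : (N : ℝ) * t - y = N * (t - y / N) := by field_simp
  rw [h1, abs_mul, abs_of_pos hN]
  have := mul_lt_mul_of_pos_left h hN
  rwa [mul_one_div_cancel hN.ne'] at this

-- In each coordinate a node whose patch contains `x` is represented by `⌊N x i⌋` or `⌊N x i⌋ + 1`.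
open Classical in
lemma sum_indicator_patch_le [NeZero N] (x : Fin d → ℝ) :
    ∑ z : Index d N, (patch z).indicator (fun _ => (1 : ℝ)) x ≤ 2 ^ d := by
  let s : Fin d → Finset (ZMod N) := fun i =>
    {((⌊(N : ℝ) * x i⌋ : ℤ) : ZMod N), ((⌊(N : ℝ) * x i⌋ + 1 : ℤ) : ZMod N)}
  have hsub : (Finset.univ.filter fun z : Index d N => x ∈ patch z) ⊆ Fintype.piFinset s := by
    intro z hz
    obtain ⟨y, hy, hlt⟩ := (Finset.mem_filter.1 hz).2
    refine Fintype.mem_piFinset.2 fun i => ?_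
    have h1 := abs_lt.1 (abs_sub_lt_one_of_abs_sub_div_lt (hlt i))
    have h2 := Int.floor_le ((N : ℝ) * x i)
    have h3 := Int.lt_floor_add_one ((N : ℝ) * x i)
    have h4 : ⌊(N : ℝ) * x i⌋ < y i + 1 := by
      have : ((⌊(N : ℝ) * x i⌋ : ℤ) : ℝ) < ((y i + 1 : ℤ) : ℝ) := by push_cast; linarith
      exact_mod_cast this
    have h5 : y i < ⌊(N : ℝ) * x i⌋ + 2 := by
      have : ((y i : ℤ) : ℝ) < ((⌊(N : ℝ) * x i⌋ + 2 : ℤ) : ℝ) := by push_cast; linarith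
      exact_mod_cast this
    rw [← hy i]
    rcases (show y i = ⌊(N : ℝ) * x i⌋ ∨ y i = ⌊(N : ℝ) * x i⌋ + 1 by omega) with h | h <;>
      simp [s, h]
  have hcard : (Finset.univ.filter fun z : Index d N => x ∈ patch z).card ≤ 2 ^ d := by
    refine (Finset.card_le_card hsub).trans ?_
    rw [Fintype.card_piFinset]
    refine (Finset.prod_le_prod' fun i _ => Finset.card_le_two).trans ?_
    simp
  have : ∑ z : Index d N, (patch z).indicator (fun _ => (1 : ℝ)) x =
      ((Finset.univ.filter fun z : Index d N => x ∈ patch z).card : ℝ) := by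
    simp [Set.indicator_apply]
  rw [this]
  exact_mod_cast hcard

lemma sum_energyFormOn_patch_le [NeZero N] {V : (Fin d → ℝ) → ℝ} {M : ℝ}
    (hV : IsBoundedPotential V M) (v : L2Pair d) :
    ∑ z : Index d N, energyFormOn V (unitCube d ∩ patch z) v v ≤ K2 d * energyForm V v v := by
  set e : (Fin d → ℝ) → ℝ := fun x => (∑ i, v.2 i x * v.2 i x) + V x * v.1 x * v.1 x with he
  have hint : Integrable e (cubeMeasure d) := hV.integrable_energy v v
  have h1 : ∀ z : Index d N, energyFormOn V (unitCube d ∩ patch z) v v =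
      ∫ x, (patch z).indicator e x ∂(cubeMeasure d) := fun z => by
    rw [cubeMeasure, setIntegral_indicator (isOpen_patch z).measurableSet]; rfl
  simp only [h1]
  rw [← integral_finsetSum _ fun z _ => hint.indicator (isOpen_patch z).measurableSet]
  change _ ≤ K2 d * ∫ x, e x ∂(cubeMeasure d)
  rw [← integral_const_mul]
  refine integral_mono (integrable_finsetSum _ fun z _ =>
    hint.indicator (isOpen_patch z).measurableSet) (hint.const_mul _) fun x => ?_
  have h2 : ∀ z : Index d N, (patch z).indicator e x =
      (patch z).indicator (fun _ => (1 : ℝ)) x * e x := fun z => by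
    by_cases hx : x ∈ patch z <;> simp [hx]
  simp only [h2, ← Finset.sum_mul]
  exact mul_le_mul_of_nonneg_right (sum_indicator_patch_le x) (energy_density_nonneg hV v x)

/-- `P` is a family of `a`-orthogonal projections onto the local spaces, defined on the whole
ambient space. -/
def IsPatchProjection (V : (Fin d → ℝ) → ℝ) (P : Index d N → L2Pair d →L[ℝ] L2Pair d) : Prop :=
  ∀ z u, P z u ∈ H10patch z ∧ ∀ v ∈ H10patch z, energyForm V (P z u) v = energyForm V u v

lemma exists_isPatchProjection {V : (Fin d → ℝ) → ℝ} {M : ℝ} (hV : IsBoundedPotential V M)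
    {c : ℝ} (hc : 0 < c) (hcoer : ∀ u ∈ H1per d, c * ‖u‖ ^ 2 ≤ energyForm V u u) :
    ∃ P : Index d N → L2Pair d →L[ℝ] L2Pair d, IsPatchProjection V P := by
  have h : ∀ z : Index d N, ∃ P : L2Pair d →L[ℝ] L2Pair d, ∀ u, P u ∈ H10patch z ∧
      ∀ v ∈ H10patch z, energyForm V (P u) v = energyForm V u v := fun z =>
    exists_form_projection (energyCLM hV) (fun u v => energyFormOn_comm V _ u v) (H10patch z)
      (Submodule.isClosed_topologicalClosure _) hc fun u hu => hcoer u (H10patch_le_H1per z hu)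
  choose P hP using h
  exact ⟨P, hP⟩

/-- Since `P z v` vanishes off the patch, `a(P z v, P z v) = a(P z v, v)` is an integral over the
patch. Local Cauchy-Schwarz bounds it by the energy of `v` there, and the finite overlap concludes.
-/
lemma sum_energyForm_projection_le [NeZero N] {V : (Fin d → ℝ) → ℝ} {M : ℝ}
    (hV : IsBoundedPotential V M) {P : Index d N → L2Pair d →L[ℝ] L2Pair d}
    (hP : IsPatchProjection V P) (v : L2Pair d) :
    ∑ z, energyForm V (P z v) (P z v) ≤ K2 d * energyForm V v v := by
  refine le_trans (Finset.sum_le_sum fun z _ => ?_) (sum_energyFormOn_patch_le (N := N) hV v)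
  have hS : unitCube d ∩ patch z ⊆ unitCube d := Set.inter_subset_left
  have h1 : energyForm V (P z v) (P z v) = energyFormOn V (unitCube d ∩ patch z) (P z v) v := by
    rw [← energyForm_eq_energyFormOn_of_vanishingOff V
      (H10patch_le_vanishingOff z (hP z v).1), (hP z v).2 _ (hP z v).1]
    exact energyFormOn_comm V _ _ _
  have h2 := energyFormOn_sq_le hV hS (P z v) v
  rw [← h1] at h2
  have h3 : energyFormOn V (unitCube d ∩ patch z) (P z v) (P z v) ≤ energyForm V (P z v) (P z v) :=
    energyFormOn_self_mono hV hS subset_rfl _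
  have h4 := energyFormOn_self_nonneg hV (unitCube d ∩ patch z) v
  have h5 : 0 ≤ energyForm V (P z v) (P z v) := energyFormOn_self_nonneg hV _ _
  rcases h5.eq_or_lt with h | h
  · rw [← h]; exact h4
  · refine le_of_mul_le_mul_left ?_ h
    rw [← sq]
    exact h2.trans (mul_le_mul_of_nonneg_right h3 h4)

/-- Both sides are continuous in `v`, so smooth `v` suffice; there Lions' lemma applies to the
pieces `η_z v`. -/
lemma energyForm_self_le_sum_projection [NeZero N] (hd : d ≠ 0) {c₀ : ℝ} (hc₀ : 0 < c₀)
    {Tβ : Set (Index d N)} {α β : ℝ} (hT : Tβ.Nonempty) (hα : 0 ≤ α) (hαβ : α ≤ β)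
    (hβ : c₀ * (N : ℝ) ^ 2 ≤ β) {M : ℝ}
    (hM : ∀ t ∈ Set.Icc (0 : ℝ) 1, deriv smoothStep t ^ 2 ≤ M)
    {P : Index d N → L2Pair d →L[ℝ] L2Pair d} (hP : IsPatchProjection (potential Tβ α β) P)
    {v : L2Pair d} (hv : v ∈ H1per d) :
    energyForm (potential Tβ α β) v v ≤
      K1 (1 + 4 * d * M * (1 / c₀ + d)) Tβ *
        ∑ z, energyForm (potential Tβ α β) (P z v) (P z v) := by
  have hV := isBoundedPotential_potential Tβ hα hαβ
  have hM0 : 0 ≤ M := (sq_nonneg _).trans (hM 0 (by simp))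
  have hF := valleyFactor_nonneg Tβ
  set V := potential Tβ α β
  set k := K1 (1 + 4 * d * M * (1 / c₀ + d)) Tβ with hk
  have hk' : k = (1 + 4 * d * M * (1 / c₀ + d)) * (2 ^ (d + 1) * (1 + valleyFactor Tβ)) := rfl
  have hk0 : 0 ≤ k := by rw [hk']; positivity
  have hcont : Continuous fun v : L2Pair d => k * ∑ z, energyForm V (P z v) (P z v) :=
    continuous_const.mul (continuous_finsetSum _ fun z _ =>
      (continuous_energyForm_self hV).comp (P z).continuous)
  refine le_of_mem_closure_smoothPairs (continuous_energyForm_self hV) hcont (fun v hv => ?_) hv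
  obtain ⟨φ, hφ, hper, -, rfl⟩ := exists_smoothPair_eq hv
  refine form_self_le_of_stable_decomposition (energyBilin hV subset_rfl)
    (energyFormOn_comm V _) (energyFormOn_self_nonneg hV _)
    (fun z => smoothPair (contDiff_bump_mul z hφ)) (fun z => P z (smoothPair hφ))
    (sum_smoothPair_bump_mul hφ)
    (fun z => (hP z _).2 _ (smoothPair_bump_mul_mem z hφ hper)) hk0 ?_
  refine (sum_energyForm_bump_mul_le hV hM hφ).trans ?_
  change _ ≤ k * energyForm V (smoothPair hφ) (smoothPair hφ)
  have h1 := friedrichs_smooth hd hc₀ hT hα hαβ hβ hφ hper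
  have h2 := mul_le_mul_of_nonneg_left h1 (show 0 ≤ 4 * d * M by positivity)
  set E := energyForm V (smoothPair hφ) (smoothPair hφ)
  have hE : 0 ≤ E := energyFormOn_self_nonneg hV _ _
  -- The cost `2E + 4dM · 2^(d+1) (1/c₀ + d) F E`, with `F` the valley factor, is absorbed into `(1
  -- + 4dM(1/c₀ + d)) 2^(d+1) (1 + F) E`.
  have hp : (2 : ℝ) ≤ 2 ^ (d + 1) := by
    rw [pow_succ]; nlinarith [one_le_pow₀ (n := d) (show (1 : ℝ) ≤ 2 by norm_num)]
  have e1 : 2 * E ≤ 2 ^ (d + 1) * E := mul_le_mul_of_nonneg_right hp hE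
  have e2 : 0 ≤ 2 ^ (d + 1) * valleyFactor Tβ * E := by positivity
  have e3 : 0 ≤ 4 * d * M * (1 / c₀ + d) * 2 ^ (d + 1) * E := by positivity
  rw [hk']
  linarith

end Bounds

/-! ### Exponential decay -/

section Decay

variable {d N : ℕ}

/-- A locally null set is null, by second countability. -/
lemma ae_eq_zero_of_notMem_essSupport (f : L2 d) :
    ∀ᵐ x ∂(cubeMeasure d), x ∉ essSupport f → f x = 0 := by
  rw [ae_iff]
  refine measure_null_of_locally_null _ fun x hx => ?_
  obtain ⟨hx1, -⟩ := Classical.not_imp.1 hx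
  simp only [essSupport, Set.mem_ofPred_eq, not_forall, not_not] at hx1
  obtain ⟨U, hU, hae⟩ := hx1
  refine ⟨U ∩ {y | ¬(y ∉ essSupport f → f y = 0)},
    Filter.inter_mem (mem_nhdsWithin_of_mem_nhds hU) self_mem_nhdsWithin, ?_⟩
  refine measure_mono_null (fun y hy => ?_) (ae_iff.1 hae)
  exact fun h => hy.2 fun _ => h hy.1

/-- The lattice point `y` (in units of the mesh width) has periodic distance less than `k` from
`S`. -/
def LatticeNear (N : ℕ) (S : Set (Fin d → ℝ)) (k : ℕ) (y : Fin d → ℤ) : Prop :=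
  ∃ s ∈ S, ∃ m : Fin d → ℤ, ∀ i, |(N : ℝ) * (s i + m i) - y i| < k

lemma LatticeNear.congr {S : Set (Fin d → ℝ)} {k : ℕ} {y y' : Fin d → ℤ}
    (h : LatticeNear N S k y) (hy : ∀ i, (y i : ZMod N) = y' i) : LatticeNear N S k y' := by
  obtain ⟨s, hs, m, hm⟩ := h
  choose n hn using fun i => (ZMod.intCast_eq_intCast_iff_dvd_sub (y i) (y' i) N).1 (hy i)
  refine ⟨s, hs, fun i => m i + n i, fun i => ?_⟩
  have h1 : (y' i : ℝ) = y i + N * n i := by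
    have : y' i = y i + N * n i := by rw [← hn i]; ring
    rw [this]; push_cast; ring
  have h2 : (N : ℝ) * (s i + ((m i + n i : ℤ) : ℝ)) - y' i = N * (s i + m i) - y i := by
    rw [h1]; push_cast; ring
  rw [h2]; exact hm i

lemma LatticeNear.succ {S : Set (Fin d → ℝ)} {k : ℕ} {y y' : Fin d → ℤ}
    (h : LatticeNear N S k y) (hy : ∀ i, |y i - y' i| ≤ 1) : LatticeNear N S (k + 1) y' := by
  obtain ⟨s, hs, m, hm⟩ := h
  refine ⟨s, hs, m, fun i => ?_⟩
  have h1 : |(y i : ℝ) - y' i| ≤ 1 := by exact_mod_cast hy i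
  have h2 : (N : ℝ) * (s i + m i) - y' i = (N * (s i + m i) - y i) + (y i - y' i) := by ring
  rw [h2, Nat.cast_succ]
  exact (abs_add_le _ _).trans_lt (add_lt_add_of_lt_of_le (hm i) h1)

lemma LatticeNear.mono {S : Set (Fin d → ℝ)} {k l : ℕ} (hkl : k ≤ l) {y : Fin d → ℤ}
    (h : LatticeNear N S k y) : LatticeNear N S l y := by
  obtain ⟨s, hs, m, hm⟩ := h
  exact ⟨s, hs, m, fun i => (hm i).trans_le (Nat.cast_le.2 hkl)⟩

/-- The nodes with periodic distance less than `k` mesh widths from `S`. -/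
def nodesNear (N : ℕ) (S : Set (Fin d → ℝ)) (k : ℕ) : Set (Index d N) :=
  {z | ∃ y : Fin d → ℤ, (∀ i, (y i : ZMod N) = z i) ∧ LatticeNear N S k y}

lemma disjoint_patch_of_notMem_nodesNear [NeZero N] {S : Set (Fin d → ℝ)} {z : Index d N} {k : ℕ}
    (hz : z ∉ nodesNear N S (k + 1)) : Disjoint S (patch z) := by
  refine Set.disjoint_left.2 fun x hxS ⟨y, hy, hlt⟩ => hz ⟨y, hy, ?_⟩
  refine LatticeNear.mono (Nat.le_add_left 1 k) ⟨x, hxS, 0, fun i => ?_⟩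
  simpa using abs_sub_lt_one_of_abs_sub_div_lt (hlt i)

/-- If two patches meet, suitable representatives of their nodes differ by less than `2` in each
coordinate, hence by at most `1` as integers. Overlap thus propagates by one mesh width. -/
lemma disjoint_patch_patch [NeZero N] {S : Set (Fin d → ℝ)} {z z' : Index d N} {k : ℕ}
    (hz : z ∉ nodesNear N S (k + 1)) (hz' : z' ∈ nodesNear N S k) :
    Disjoint (patch z') (patch z) := by
  refine Set.disjoint_left.2 fun x ⟨y', hy', hlt'⟩ ⟨y, hy, hlt⟩ => hz ⟨y, hy, ?_⟩
  obtain ⟨w, hw, hnear⟩ := hz'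
  refine (hnear.congr fun i => (hw i).trans (hy' i).symm).succ fun i => ?_
  have h1 := abs_lt.1 (abs_sub_lt_one_of_abs_sub_div_lt (hlt i))
  have h2 := abs_lt.1 (abs_sub_lt_one_of_abs_sub_div_lt (hlt' i))
  have h3 : y' i - y i < 2 := by
    have : ((y' i - y i : ℤ) : ℝ) < ((2 : ℤ) : ℝ) := by push_cast; linarith
    exact_mod_cast this
  have h4 : -2 < y' i - y i := by
    have : ((-2 : ℤ) : ℝ) < ((y' i - y i : ℤ) : ℝ) := by push_cast; linarith
    exact_mod_cast this
  rw [abs_le]; omega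

lemma patch_subset_periodicBall [NeZero N] {S : Set (Fin d → ℝ)} {z : Index d N} {k : ℕ}
    (hz : z ∈ nodesNear N S k) : patch z ⊆ periodicBall (((k + 1 : ℕ) : ℝ) / N) S := by
  rintro x ⟨y, hy, hlt⟩
  have hN : (0 : ℝ) < N := Nat.cast_pos.2 (NeZero.pos N)
  obtain ⟨w, hw, hnear⟩ := hz
  obtain ⟨s, hs, m, hm⟩ := hnear.congr fun i => (hw i).trans (hy i).symm
  refine ⟨s, hs, m, (dist_pi_lt_iff (by positivity)).2 fun i => ?_⟩
  rw [Real.dist_eq, lt_div_iff₀ hN, mul_comm]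
  nth_rewrite 1 [← abs_of_pos hN]
  rw [← abs_mul]
  have h1 := abs_lt.1 (abs_sub_lt_one_of_abs_sub_div_lt (hlt i))
  have h2 := abs_lt.1 (hm i)
  rw [abs_lt]
  push_cast
  constructor <;> linarith

lemma isOpen_periodicBall (r : ℝ) (S : Set (Fin d → ℝ)) : IsOpen (periodicBall r S) := by
  have : periodicBall r S = ⋃ y ∈ S, ⋃ k : Fin d → ℤ,
      Metric.ball (fun i => y i + k i : Fin d → ℝ) r := by
    ext x; simp [periodicBall]
  rw [this]
  exact isOpen_biUnion fun y _ => isOpen_iUnion fun k => Metric.isOpen_ball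

variable {V : (Fin d → ℝ) → ℝ} {M : ℝ}

lemma eq_zero_of_energyForm_self_eq_zero {c : ℝ} (hc : 0 < c)
    (hcoer : ∀ u ∈ H1per d, c * ‖u‖ ^ 2 ≤ energyForm V u u) {u : L2Pair d} (hu : u ∈ H1per d)
    (h0 : energyForm V u u = 0) : u = 0 := by
  have h := hcoer u hu
  rw [h0] at h
  have h1 : ‖u‖ ^ 2 ≤ 0 := by
    by_contra hlt
    have := mul_pos hc (not_le.1 hlt)
    linarith
  exact norm_eq_zero.1 (pow_eq_zero_iff two_ne_zero |>.1 (le_antisymm h1 (sq_nonneg _)))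

lemma IsPatchProjection.eq_zero {c : ℝ} (hc : 0 < c)
    (hcoer : ∀ u ∈ H1per d, c * ‖u‖ ^ 2 ≤ energyForm V u u)
    {P : Index d N → L2Pair d →L[ℝ] L2Pair d} (hP : IsPatchProjection V P) {z : Index d N}
    {u : L2Pair d} (hu : ∀ v ∈ H10patch z, energyForm V u v = 0) : P z u = 0 :=
  eq_zero_of_energyForm_self_eq_zero hc hcoer (H10patch_le_H1per z (hP z u).1)
    (((hP z u).2 _ (hP z u).1).trans (hu _ (hP z u).1))

/-- One step of the damped subspace correction method. -/
noncomputable def correctionStep [NeZero N] (P : Index d N → L2Pair d →L[ℝ] L2Pair d) (θ : ℝ)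
    (u : L2Pair d) : L2Pair d := u - θ • ∑ z, P z u

lemma correctionStep_iterate_mem [NeZero N] {P : Index d N → L2Pair d →L[ℝ] L2Pair d}
    (hP : IsPatchProjection V P) (θ : ℝ) {u : L2Pair d} (hu : u ∈ H1per d) (k : ℕ) :
    (correctionStep P θ)^[k] u ∈ H1per d := by
  induction k with
  | zero => exact hu
  | succ k ih =>
    rw [Function.iterate_succ_apply']
    exact sub_mem ih (Submodule.smul_mem _ _ (Submodule.sum_mem _ fun z _ =>
      H10patch_le_H1per z (hP z _).1))

/-- The error of the `k`-th iterate is supported in the patches near the support of `f`. -/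
lemma sub_correctionStep_iterate_mem [NeZero N] {c : ℝ} (hc : 0 < c)
    (hcoer : ∀ u ∈ H1per d, c * ‖u‖ ^ 2 ≤ energyForm V u u)
    {P : Index d N → L2Pair d →L[ℝ] L2Pair d}
    (hP : IsPatchProjection V P) (θ : ℝ) {f : L2 d} {u : H1per d} (hu : IsSolution V f u) (k : ℕ) :
    (u : L2Pair d) - (correctionStep P θ)^[k] u ∈
      ⨆ z ∈ nodesNear N (essSupport f) k, H10patch z := by
  have hle : ∀ {k} {z : Index d N}, z ∈ nodesNear N (essSupport f) k →
      H10patch z ≤ ⨆ z ∈ nodesNear N (essSupport f) k, H10patch z := fun {k z} hz =>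
    le_biSup (f := fun z : Index d N => H10patch z) hz
  induction k with
  | zero => simp
  | succ k ih =>
    set w := (correctionStep P θ)^[k] (u : L2Pair d) with hw
    rw [Function.iterate_succ_apply', ← hw, correctionStep]
    have hsplit : (u : L2Pair d) - (w - θ • ∑ z, P z w) = (u - w) + θ • ∑ z, P z w := by abel
    rw [hsplit]
    have hmono : (⨆ z ∈ nodesNear N (essSupport f) k, H10patch z) ≤
        ⨆ z ∈ nodesNear N (essSupport f) (k + 1), H10patch z :=
      iSup₂_le fun z ⟨y, hy, h⟩ => hle ⟨y, hy, h.mono (Nat.le_succ k)⟩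
    refine add_mem (hmono ih)
      (Submodule.smul_mem _ _ (Submodule.sum_mem _ fun z _ => ?_))
    · by_cases hz : z ∈ nodesNear N (essSupport f) (k + 1)
      · exact hle hz (hP z w).1
      -- Beyond layer `k + 1` nothing is added: `P z u = 0` because `f` vanishes on the patch, and
      -- `P z (u - w) = 0` because all earlier patches are disjoint from it.
      · have h1 : P z u = 0 := hP.eq_zero hc hcoer fun v hv => by
          have hsol := hu ⟨v, H10patch_le_H1per z hv⟩
          rw [hsol]
          refine integral_eq_zero_of_ae ?_
          have hvan := H10patch_le_vanishingOff z hv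
          filter_upwards [show ∀ᵐ x ∂(cubeMeasure d), _ from hvan,
            show ∀ᵐ x ∂(cubeMeasure d), _ from ae_eq_zero_of_notMem_essSupport f] with x e1 e2
          by_cases hx : x ∈ patch z
          · simp [e2 fun h => Set.disjoint_left.1 (disjoint_patch_of_notMem_nodesNear hz) h hx]
          · simp [(e1 hx).1]
        have h2 : P z (u - w) = 0 := by
          have hker : (⨆ z ∈ nodesNear N (essSupport f) k, H10patch z) ≤ (P z).ker := by
            refine iSup₂_le fun z' hz' v hv => ?_
            exact hP.eq_zero hc hcoer fun v' hv' => energyForm_eq_zero_of_disjoint V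
              (disjoint_patch_patch hz hz') (H10patch_le_vanishingOff z' hv)
              (H10patch_le_vanishingOff z hv')
          exact hker ih
        have h3 : P z w = 0 := by
          rw [map_sub, h1, zero_sub, neg_eq_zero] at h2
          exact h2
        rw [h3]; exact zero_mem _

lemma energyNormOn_eq_of_sub_mem_vanishingOff {U : Set (Fin d → ℝ)} (hU : MeasurableSet U)
    {u w : L2Pair d} (h : u - w ∈ vanishingOff U) :
    energyNormOn V (unitCube d \ U) u = energyNormOn V (unitCube d \ U) w := by
  unfold energyNormOn energyFormOn
  congr 1
  refine setIntegral_congr_ae ((measurableSet_unitCube d).diff hU) ?_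
  have h1 := (ae_restrict_iff' (measurableSet_unitCube d)).1 h
  have h2 := (ae_restrict_iff' (measurableSet_unitCube d)).1 (coeFn_pair_add (u - w) w)
  filter_upwards [h1, h2] with x e1 e2 hx
  have e3 := e1 hx.1 hx.2
  have e4 := e2 hx.1
  rw [sub_add_cancel] at e4
  simp only [e4.1, e4.2, e3.1, e3.2, zero_add]

theorem energyNormOn_le_of_contraction [NeZero N] {c : ℝ} (hc : 0 < c)
    (hcoer : ∀ u ∈ H1per d, c * ‖u‖ ^ 2 ≤ energyForm V u u)
    (hV : IsBoundedPotential V M) {P : Index d N → L2Pair d →L[ℝ] L2Pair d}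
    (hP : IsPatchProjection V P) {θ γ : ℝ} (hγ : 1 / 2 ≤ γ)
    (hcontr : ∀ v ∈ H1per d, energyNorm V (correctionStep P θ v) ≤ γ * energyNorm V v)
    {f : L2 d} {u : H1per d} (hu : IsSolution V f u) (k : ℕ) :
    energyNormOn V (unitCube d \ periodicBall ((k : ℝ) / N) (essSupport f)) u ≤
      2 * γ ^ k * energyNorm V u := by
  have hmono : ∀ (U : Set (Fin d → ℝ)) (v : L2Pair d),
      energyNormOn V (unitCube d \ U) v ≤ energyNorm V v := fun U v =>
    Real.sqrt_le_sqrt (energyFormOn_self_mono hV Set.sdiff_subset subset_rfl v)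
  have hnorm : 0 ≤ energyNorm V u := Real.sqrt_nonneg _
  have hit : ∀ k, energyNorm V ((correctionStep P θ)^[k] u) ≤ γ ^ k * energyNorm V u := by
    intro k
    induction k with
    | zero => simp
    | succ k ih =>
      rw [Function.iterate_succ_apply', pow_succ']
      refine (hcontr _ (correctionStep_iterate_mem hP θ u.2 k)).trans ?_
      rw [mul_assoc]
      exact mul_le_mul_of_nonneg_left ih (by linarith)
  cases k with
  | zero =>
    refine (hmono _ _).trans ?_
    rw [pow_zero]; linarith
  | succ k =>
    have h1 := sub_correctionStep_iterate_mem hc hcoer hP θ hu k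
    have h2 : (⨆ z ∈ nodesNear N (essSupport f) k, H10patch z) ≤
        vanishingOff (periodicBall (((k + 1 : ℕ) : ℝ) / N) (essSupport f)) :=
      iSup₂_le fun z hz => (H10patch_le_vanishingOff z).trans
        (vanishingOff_mono (patch_subset_periodicBall hz))
    -- Patches of layer `k` reach up to distance `(k + 1)ε`, so the ball of index `k + 1` is matched
    -- with the `k`-th iterate; `γ ≥ 1/2` then gives `γ^k ≤ 2 γ^(k+1)`.
    rw [energyNormOn_eq_of_sub_mem_vanishingOff (isOpen_periodicBall _ _).measurableSet (h2 h1)]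
    refine (hmono _ _).trans ((hit k).trans (mul_le_mul_of_nonneg_right ?_ hnorm))
    have h3 : 0 ≤ γ ^ k := pow_nonneg (by linarith) k
    rw [pow_succ]
    nlinarith

end Decay

/-! ### The periodic Schrödinger problem -/

section Main

variable {d N : ℕ}

lemma existsUnique_isSolution {V : (Fin d → ℝ) → ℝ} {M c : ℝ} (hV : IsBoundedPotential V M)
    (hc : 0 < c) (hcoer : ∀ u ∈ H1per d, c * ‖u‖ ^ 2 ≤ energyForm V u u) (f : L2 d) :
    ∃! u : H1per d, IsSolution V f u := by
  have : CompleteSpace (H1per d) :=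
    (Submodule.isClosed_topologicalClosure _).completeSpace_coe
  obtain ⟨A, hA⟩ : ∃ A : H1per d →L[ℝ] H1per d →L[ℝ] ℝ, ∀ u v : H1per d,
      A u v = energyForm V u v :=
    ⟨(energyCLM hV).bilinearComp (H1per d).subtypeL (H1per d).subtypeL, fun u v => rfl⟩
  obtain ⟨l, hl⟩ : ∃ l : H1per d →L[ℝ] ℝ, ∀ v : H1per d,
      l v = ∫ x in unitCube d, f x * (v : L2Pair d).1 x :=
    ⟨(innerSL ℝ f).comp ((ContinuousLinearMap.fst ℝ (L2 d) (Fin d → L2 d)).comp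
      (H1per d).subtypeL), fun v => (integral_mul_L2 f _).symm⟩
  obtain ⟨u, hu⟩ := exists_form_eq_of_coercive A
    (fun u v => by rw [hA, hA]; exact energyFormOn_comm V _ _ _) hc
    (fun u => by rw [hA]; exact hcoer u u.2) l
  refine ⟨u, fun v => by rw [← hA, hu, hl], fun w hw => ?_⟩
  have h0 : ∀ v : H1per d, A (w - u) v = 0 := fun v => by
    rw [map_sub, sub_apply, hu, hA, hw v, hl, sub_self]
  have h1 : energyForm V ((w - u : H1per d) : L2Pair d) ((w - u : H1per d) : L2Pair d) = 0 := by
    rw [← hA]; exact h0 _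
  have h2 := eq_zero_of_energyForm_self_eq_zero hc hcoer (w - u).2 h1
  exact sub_eq_zero.1 (Subtype.ext h2)

lemma one_le_K1 {C : ℝ} (hC : 1 ≤ C) (Tβ : Set (Index d N)) : 1 ≤ K1 C Tβ := by
  have hK : K1 C Tβ = C * (2 ^ (d + 1) * (1 + valleyFactor Tβ)) := rfl
  have h1 := valleyFactor_nonneg Tβ
  have h2 : (1 : ℝ) ≤ 2 ^ (d + 1) := one_le_pow₀ (by norm_num)
  rw [hK]
  exact one_le_mul_of_one_le_of_one_le hC
    (one_le_mul_of_one_le_of_one_le h2 (by linarith))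

/-- Because `K₁⁻¹ ≤ 1 ≤ K₂`, the factor is at least `1/2`, which is what permits `C₂ = 2`. -/
lemma gammaP_mem {C : ℝ} (hC : 1 ≤ C) (Tβ : Set (Index d N)) :
    1 / 2 ≤ gammaP C Tβ ∧ gammaP C Tβ < 1 := by
  have h1 := one_le_K1 hC Tβ
  have h2 : (K1 C Tβ)⁻¹ ≤ 1 := inv_le_one_of_one_le₀ h1
  have h3 : 0 < (K1 C Tβ)⁻¹ := by positivity
  have h4 : 1 ≤ K2 d := one_le_pow₀ (by norm_num)
  unfold gammaP
  rw [div_le_div_iff₀ two_pos (by positivity), div_lt_one (by positivity)]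
  constructor <;> linarith

lemma energyNorm_correctionStep_le [NeZero N] (hd : d ≠ 0) {c₀ : ℝ} (hc₀ : 0 < c₀)
    {Tβ : Set (Index d N)} {α β : ℝ} (hT : Tβ.Nonempty) (hα : 0 ≤ α) (hαβ : α ≤ β)
    (hβ : c₀ * (N : ℝ) ^ 2 ≤ β) {M : ℝ}
    (hM : ∀ t ∈ Set.Icc (0 : ℝ) 1, deriv smoothStep t ^ 2 ≤ M)
    {P : Index d N → L2Pair d →L[ℝ] L2Pair d} (hP : IsPatchProjection (potential Tβ α β) P)
    {v : L2Pair d} (hv : v ∈ H1per d) :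
    energyNorm (potential Tβ α β)
        (correctionStep P (scaling (1 + 4 * d * M * (1 / c₀ + d)) Tβ) v) ≤
      gammaP (1 + 4 * d * M * (1 / c₀ + d)) Tβ * energyNorm (potential Tβ α β) v := by
  have hV := isBoundedPotential_potential Tβ hα hαβ
  have hM0 : 0 ≤ M := (sq_nonneg _).trans (hM 0 (by simp))
  have hC : 1 ≤ 1 + 4 * d * M * (1 / c₀ + d) := le_add_of_nonneg_right (by positivity)
  have hK1 := one_le_K1 hC Tβ
  have hK2 : 0 < K2 d := by unfold K2; positivity
  have hlow := fun {u : L2Pair d} (hu : u ∈ H1per d) =>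
    energyForm_self_le_sum_projection hd hc₀ hT hα hαβ hβ hM hP hu
  generalize 1 + 4 * d * M * (1 / c₀ + d) = C at *
  obtain ⟨B, hB⟩ : ∃ B : LinearMap.BilinForm ℝ (H1per d), ∀ u v : H1per d,
      B u v = energyForm (potential Tβ α β) u v :=
    ⟨(energyBilin hV subset_rfl).restrict (H1per d), fun u v => rfl⟩
  -- The lower spectral bound is available only on `H¹_per(D)`, so the form and the projections are
  -- restricted to it.
  obtain ⟨Q, hQ⟩ : ∃ Q : Index d N → H1per d →ₗ[ℝ] H1per d, ∀ z u, (Q z u : L2Pair d) = P z u :=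
    ⟨fun z => (P z : L2Pair d →ₗ[ℝ] L2Pair d).restrict
      fun u _ => H10patch_le_H1per z (hP z u).1, fun z u => rfl⟩
  have h := subspace_correction_contraction B
    (fun u v => by rw [hB, hB]; exact energyFormOn_comm _ _ _ _)
    (fun u => by rw [hB]; exact energyFormOn_self_nonneg hV _ _) Q
    (fun z u v => by rw [hB, hB, hQ, hQ]; exact (hP z u).2 _ (hP z v).1)
    (zero_lt_one.trans_le hK1) hK2
    (fun u => by simp only [hB, hQ]; exact hlow u.2)
    (fun u => by simp only [hB, hQ]; exact sum_energyForm_projection_le hV hP u) ⟨v, hv⟩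
  rw [hB, hB] at h
  have hcoe : ((⟨v, hv⟩ - (1 / (K2 d + (K1 C Tβ)⁻¹)) • ∑ z, Q z ⟨v, hv⟩ : H1per d) : L2Pair d) =
      correctionStep P (scaling C Tβ) v := by
    simp only [correctionStep, scaling, Submodule.coe_sub, Submodule.coe_smul, Submodule.coe_sum,
      hQ]
  rw [hcoe] at h
  exact h

end Main

end Schrodinger

open Schrodinger in
theorem mainTheorem2 (d : ℕ) (hd : 1 ≤ d) (c₀ : ℝ) (hc₀ : 0 < c₀) :
    ∃ C₁ > 0, ∃ C₂ > 0,
      ∀ (N : ℕ) [NeZero N] (Tβ : Set (Schrodinger.Index d N)) (α β : ℝ),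
        Tβ.Nonempty → 0 ≤ α → α ≤ β → c₀ * (N : ℝ) ^ 2 ≤ β →
        (0 < Schrodinger.gammaP C₁ Tβ ∧ Schrodinger.gammaP C₁ Tβ < 1) ∧
        (∃ P : Schrodinger.Index d N → (Schrodinger.H1per d →ₗ[ℝ] Schrodinger.H1per d),
          (∀ z, Schrodinger.IsLocalProjection (Schrodinger.potential Tβ α β) z (P z)) ∧
          ∀ v : Schrodinger.H1per d,
            Schrodinger.energyNorm (Schrodinger.potential Tβ α β)
                ((v - Schrodinger.scaling C₁ Tβ • ∑ z, P z v : Schrodinger.H1per d) :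
                  Schrodinger.L2Pair d) ≤
              Schrodinger.gammaP C₁ Tβ *
                Schrodinger.energyNorm (Schrodinger.potential Tβ α β) v) ∧
        ∀ f : Schrodinger.L2 d,
          (∃! u : Schrodinger.H1per d,
            Schrodinger.IsSolution (Schrodinger.potential Tβ α β) f u) ∧
          ∀ u : Schrodinger.H1per d,
            Schrodinger.IsSolution (Schrodinger.potential Tβ α β) f u →
            ∀ k : ℕ,
              Schrodinger.energyNormOn (Schrodinger.potential Tβ α β)
                  (Schrodinger.unitCube d \
                    Schrodinger.periodicBall ((k : ℝ) / N) (Schrodinger.essSupport f)) u ≤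
                C₂ * Schrodinger.gammaP C₁ Tβ ^ k *
                  Schrodinger.energyNorm (Schrodinger.potential Tβ α β) u := by
  have hd0 : d ≠ 0 := by omega
  obtain ⟨M, hM⟩ := exists_bound_deriv_smoothStep
  have hM0 : 0 ≤ M := (sq_nonneg _).trans (hM 0 (by simp))
  have hC : 1 ≤ 1 + 4 * d * M * (1 / c₀ + d) := le_add_of_nonneg_right (by positivity)
  -- `C₁` combines the bound `M` for the squared slope of the step function with the Friedrichs
  -- constant, and `C₂ = 2` pays for the index shift.
  refine ⟨1 + 4 * d * M * (1 / c₀ + d), by positivity, 2, two_pos, ?_⟩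
  intro N _ Tβ α β hT hα hαβ hβ
  have hV := isBoundedPotential_potential Tβ hα hαβ
  obtain ⟨hγ, hγ1⟩ := gammaP_mem hC Tβ
  obtain ⟨c, hc, hcoer⟩ := exists_coercive hd0 hc₀ hT hα hαβ hβ
  obtain ⟨P, hP⟩ := exists_isPatchProjection (N := N) hV hc hcoer
  refine ⟨⟨by linarith, hγ1⟩, ?_, fun f => ⟨existsUnique_isSolution hV hc hcoer f, ?_⟩⟩
  · have hPmem : ∀ z, ∀ u ∈ H1per d, (P z : L2Pair d →ₗ[ℝ] L2Pair d) u ∈ H1per d :=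
      fun z u _ => H10patch_le_H1per z (hP z u).1
    refine ⟨fun z => (P z : L2Pair d →ₗ[ℝ] L2Pair d).restrict (hPmem z), fun z u => hP z u,
      fun v => ?_⟩
    have h := energyNorm_correctionStep_le hd0 hc₀ hT hα hαβ hβ hM hP v.2
    convert h using 2
    simp [correctionStep]
  · intro u hu k
    exact energyNormOn_le_of_contraction hc hcoer hV hP hγ
      (fun v hv => energyNorm_correctionStep_le hd0 hc₀ hT hα hαβ hβ hM hP hv) hu k
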